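/- **Setting.** Let $(M,g)$ be a four-dimensional Lorentzian spacetime (a coordinate domain) with two Killing fields $\kappa_0,\kappa_1$ whose Gram matrix $\mathcal G_{ab}=g(\kappa_a,\kappa_b)$ (inverse $\mathcal G^{ab}$) has signature $(-+)$, foliated by timelike slices $\{\Omega=\mathrm{const}\}$ to which the Killing fields are tangent. Let $\varphi=1/|d\Omega|$, let $n$ be the outer unit normal, and write $f'=\varphi\, n^\alpha\nabla_\alpha f$. The foliation generates a slice-reducible (exact or conformal) Killing tensor: the second fundamental form $\chi$ of the slices satisfies $\chi(\kappa_a,\sigma)=0$ and $\chi(\sigma,\sigma')=\chi_\tau g(\sigma,\sigma')$ for $\sigma,\sigma'$ tangent to the slices and orthogonal to $\kappa_0,\kappa_1$; $\Psi=\ln\varphi^2+\tilde\Psi$ with $\tilde\Psi$ constant on slices and $n^\alpha\nabla_\alpha\tilde\Psi=2(\chi_\tau-n^\alpha\nabla_\alpha\ln\varphi)$; and there is $\gamma^{ab}$, constant on slices, with $\gamma^{ab}-e^\Psi\mathcal G^{ab}$ constant along the normals. The particles have a mass function $m\ge 0$ (possibly variable or zero), invariant under the Killing flows, for which there is a function $\mu$,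 constant on slices, such that $\mu-e^\Psi m^2$ is constant along the normals. The Carter constant of a momentum $p$ with charges $q_a=g(\kappa_a,p)$ is $\mathcal C=\gamma^{ab}q_aq_b+e^\Psi g(n,p)^2+\mu$. Let $c$ be an integral curve of the normal field, parametrized by $\Omega\in(a,\infty)$. Assume that along $c$ the metric tends to the flat one in spherical coordinates $(t,\phi,r,\theta)$ with $\kappa_0=\partial_t$, $\kappa_1=\partial_\phi$: $\theta$ is constant along the normals and the Killing orbits, $\theta\in(0,\pi)$ on $c$, and, as $\Omega\to\infty$, $r\to\infty$, $\mathcal G_{tt}\to-1$, $\mathcal G_{t\phi}$ has a finite limit (zero without NUT charge), $\mathcal G_{\phi\phi}/(r^2\sin^2\theta)\to1$, $r^2g^{\theta\theta}\to1$. The observer at $c(\bar\Omega)$ (bars denote values there) has timelike velocity $\bar v^a\kappa_a$, norm $\bar v=\sqrt{-\bar{\mathcal G}_{ab}\bar v^a\bar v^b}$, and conserved quantities $\bar v_a=\bar{\mathcal G}_{ab}\bar v^b$; assume the limits $\bar v^a\to\bar v^a_\infty$, $\bar v_a\to\bar v_a^\infty$ as $\bar\Omega\to\infty$. Let $\bar\tau^a=\bar{\mathcal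 G}^{ab}\sqrt{-\det\bar{\mathcal G}}\,\epsilon_{bc}\bar v^c$ with $\epsilon_{01}=-\epsilon^{01}=1$. The tetrad is $e_0=\bar v^a\kappa_a/\bar v$, $e_1=\bar\tau^a\kappa_a/\bar v$, $e_3=-n$, and $e_2$ a unit vector completing it. Fix the observed energy $E>0$. The direction $(\Phi,\Theta)$ of the celestial sphere corresponds to the momentum $$\tfrac{E}{\bar v}e_0+\sqrt{E^2/\bar v^2-\bar m^2}\,(\sin\Phi\sin\Theta\, e_1+\cos\Phi\sin\Theta\, e_2+\cos\Theta\, e_3),$$ and $X=-2\tan\frac\Theta2\sin\Phi$, $Y=-2\tan\frac\Theta2\cos\Phi$. Fix a slice $\Omega=\Omega_0>a$. A direction with $0\le\Theta\le\pi/2$ is a point of the shadow boundary for this slice with impact parameter vector $\rho_a$, $\bar v^a\rho_a<0$, if $\bar m\bar v\le E$, the charges are $q_a=-E\rho_a/(\bar v^b\rho_b)$, and the particle has the same charges and Carter constant as a particle moving tangentially to the slice $\Omega=\Omega_0$ (with $g(p,p)=-m^2$) at a point where $(e^\Psi\mathcal G^{ab})'q_aq_b+(e^\Psi m^2)'=0$,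 that is, where the slice is a massive particle surface for the charges $q_a$. With $m_E^2=\bar v^2m^2/E^2$, the shadow matrix is $\mathcal S^{ab}=e^\Psi(\mathcal G^{ab}+m_E^2\,\bar v^a\bar v^b/\bar v^2)$; in $(\mathcal S^{ab})'$ the observer is not differentiated. Assume $\bar m\to\bar m_\infty$, put $\bar v_\infty=\sqrt{-\bar v^a_\infty\bar v_a^\infty}$, $\bar m_{E\infty}^2=\bar v_\infty^2\bar m_\infty^2/E^2$, $m_{E\infty}^2=\bar v_\infty^2m^2/E^2$, and assume $\bar m_{E\infty}^2<1$. Let $\mathcal S_\infty^{ab}=e^\Psi(\mathcal G^{ab}+m^2_{E\infty}\bar v^a_\infty\bar v^b_\infty/\bar v_\infty^2)$. Matrices without a bar are taken at $c(\Omega_0)$. **Claim.** As $\bar\Omega\to\infty$: 1. $\bar\Psi\to\infty$, $\bar v\to\bar v_\infty$, $\bar\tau^a\sqrt{-\det\bar{\mathcal G}}\to\bar\tau^a_\infty=\epsilon^{ab}\bar v_b^\infty$, $\mathcal S^{ab}\to\mathcal S^{ab}_\infty$, and $\alpha_\infty=\lim e^{\bar\Psi/2}/\sqrt{-\det\bar{\mathcal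 G}}$ exists in $(0,\infty)$. 2. For every family of points of the shadow boundary, defined for all large $\bar\Omega$, with $\rho\to\rho^\infty$ and $\bar v^a_\infty\rho^\infty_a<0$, one has $(\mathcal S^{ab}_\infty)'\rho^\infty_a\rho^\infty_b=0$, $\mathcal S^{ab}_\infty\rho^\infty_a\rho^\infty_b\le0$, and $$Xe^{\bar\Psi/2}\to X_\infty=\frac{\alpha_\infty\,\bar\tau^a_\infty\rho^\infty_a}{\sqrt{1-\bar m_{E\infty}^2}\;\bar v^a_\infty\rho^\infty_a},\qquad Ye^{\bar\Psi/2}\to Y_\infty=\pm\frac{\bar v_\infty\sqrt{-\mathcal S^{ab}_\infty\rho^\infty_a\rho^\infty_b}}{\sqrt{1-\bar m_{E\infty}^2}\;\bar v^a_\infty\rho^\infty_a},$$ where the limit of $Y e^{\bar\Psi/2}$ is asserted with sign $\pm$ for each of the mirror branches $\pm\cos\Phi\ge0$, and $|Y|e^{\bar\Psi/2}\to|Y_\infty|$ in any case. 3. Conversely, every family $\rho\to\rho^\infty$ with $(\mathcal S^{ab})'\rho_a\rho_b=0$ for all large $\bar\Omega$, $\bar v^a_\infty\rho^\infty_a<0$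 and $\mathcal S_\infty^{ab}\rho^\infty_a\rho^\infty_b<0$ comes, for large $\bar\Omega$ and on each of the two branches, from points of the shadow boundary; and every solution $\rho^\infty$ of $(\mathcal S^{ab}_\infty)'\rho^\infty_a\rho^\infty_b=0$ with $\bar v_\infty^a\rho^\infty_a<0$ is the limit of such a family of solutions if $\det(\mathcal S_\infty^{ab})'<0$. 4. Scaling, where $|_0$ denotes the formulas for $X_\infty,Y_\infty$ with $m=0$ (thus $\mathcal S_\infty^{ab}$ replaced by $e^\Psi\mathcal G^{ab}$ and $\bar m_{E\infty}$ by $0$). If $e^\Psi m_{E\infty}^2$ and its derivative $(e^\Psi m_{E\infty}^2)'$ vanish at $c(\Omega_0)$, the equations for $\rho^\infty$ coincide and, for every $\rho^\infty$ with $\bar v_\infty^a\rho_a^\infty<0$, $(X_\infty,Y_\infty)=(X_\infty,Y_\infty)|_0/\sqrt{1-\bar m^2_{E\infty}}$. More generally, for a family of mass functions (each as above) for which these two quantities at $c(\Omega_0)$ tend to $0$, if solutions $\rho^\infty$ of $(\mathcal S_\infty^{ab})'\rho^\infty_a\rho^\infty_b=0$ tend to $\rho^0$ with $\bar v_\infty^a\rho^0_a<0$,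 then $\rho^0$ solves the massless equation and $\sqrt{1-\bar m^2_{E\infty}}\,(X_\infty,Y_\infty)\to(X_\infty,Y_\infty)|_0$ evaluated at $\rho^0$; and every massless solution $\rho^0$ with $\bar v_\infty^a\rho^0_a<0$ and $\det(e^\Psi\mathcal G^{ab})'<0$ is such a limit. -/

import Mathlib

open Filter Topology Matrix
open scoped ContDiff

noncomputable section

namespace Shadow

/-- Points of a coordinate domain of a four-dimensional spacetime, and also components of tangent
vectors and covectors in these coordinates. -/
abbrev Coord := Fin 4 → ℝ

/-- The partial derivative of `f` along the coordinate number `μ`. -/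
def pd (μ : Fin 4) (f : Coord → ℝ) (x : Coord) : ℝ := fderiv ℝ f x (Pi.single μ 1)

/-- The components of the differential of `f`. -/
def differential (f : Coord → ℝ) (x : Coord) : Coord := fun μ => pd μ f x

/-- The scalar product of two tangent vectors at `x` for the metric `g`. -/
def ip (g : Coord → Matrix (Fin 4) (Fin 4) ℝ) (x : Coord) (u w : Coord) : ℝ :=
  u ⬝ᵥ (g x *ᵥ w)

/-- The scalar product of two covectors at `x` for the inverse of the metric `g`. -/
def coip (g : Coord → Matrix (Fin 4) (Fin 4) ℝ) (x : Coord) (p q : Coord) : ℝ :=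
  p ⬝ᵥ ((g x)⁻¹ *ᵥ q)

/-- The Lie derivative `(L_k g)_{αβ}` of the metric along the vector field `k`. -/
def lieMetric (g : Coord → Matrix (Fin 4) (Fin 4) ℝ) (k : Coord → Coord) (α β : Fin 4)
    (x : Coord) : ℝ :=
  ∑ γ, (k x γ * pd γ (fun y => g y α β) x
    + g x γ β * pd α (fun y => k y γ) x + g x α γ * pd β (fun y => k y γ) x)

/-- The Gram matrix `G_{ab} = g(κ_a, κ_b)` of two vector fields. -/
def gramOf (g : Coord → Matrix (Fin 4) (Fin 4) ℝ) (κ : Fin 2 → Coord → Coord) (x : Coord) :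
    Matrix (Fin 2) (Fin 2) ℝ :=
  Matrix.of fun a b => ip g x (κ a x) (κ b x)

/-- A four-dimensional Lorentzian spacetime, written in arbitrary coordinates on an open set `U`,
with two Killing vector fields `κ 0`, `κ 1` whose Gram matrix has signature `(-+)`, foliated by the
timelike hypersurfaces (slices) `Ω = const`, to which the Killing vectors are tangent. -/
structure FoliatedSpacetime where
  U : Set Coord
  g : Coord → Matrix (Fin 4) (Fin 4) ℝ
  κ : Fin 2 → Coord → Coord
  /-- The foliation parameter; it grows towards infinity. -/
  Ω : Coord → ℝ
  isOpen_U : IsOpen U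
  smooth_g : ∀ α β, ContDiffOn ℝ ∞ (fun x => g x α β) U
  smooth_κ : ∀ a α, ContDiffOn ℝ ∞ (fun x => κ a x α) U
  smooth_Ω : ContDiffOn ℝ ∞ Ω U
  symm_g : ∀ x ∈ U, (g x).IsSymm
  lorentzian : ∀ x ∈ U, ∃ P : Matrix (Fin 4) (Fin 4) ℝ, P.det ≠ 0 ∧
    Pᵀ * g x * P = Matrix.diagonal ![-1, 1, 1, 1]
  killing : ∀ a, ∀ x ∈ U, ∀ α β, lieMetric g (κ a) α β x = 0
  gram_signature : ∀ x ∈ U, (gramOf g κ x).det < 0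
  slice_timelike : ∀ x ∈ U, 0 < coip g x (differential Ω x) (differential Ω x)
  killing_tangent : ∀ a, ∀ x ∈ U, κ a x ⬝ᵥ differential Ω x = 0

namespace FoliatedSpacetime

variable (M : FoliatedSpacetime)

/-- The Gram matrix `G_{ab}` of the Killing vectors; its inverse is `G^{ab}`. -/
def gram (x : Coord) : Matrix (Fin 2) (Fin 2) ℝ := gramOf M.g M.κ x

/-- The lapse function `φ = 1 / |dΩ|`. -/
def lapse (x : Coord) : ℝ :=
  1 / Real.sqrt (coip M.g x (differential M.Ω x) (differential M.Ω x))

/-- The unit normal covector `n_α = φ ∂_α Ω` of the slices. -/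
def normalLow (x : Coord) : Coord := M.lapse x • differential M.Ω x

/-- The outer unit normal vector `n^α` of the slices. -/
def normal (x : Coord) : Coord := (M.g x)⁻¹ *ᵥ M.normalLow x

/-- The derivative `n^α ∇_α f`. -/
def normalDeriv (f : Coord → ℝ) (x : Coord) : ℝ := fderiv ℝ f x (M.normal x)

/-- The derivative `f' = φ n^α ∇_α f` with respect to the foliation parameter. -/
def prime (f : Coord → ℝ) (x : Coord) : ℝ := M.lapse x * M.normalDeriv f x

/-- `f` is constant on every slice, i.e. its derivatives tangent to the slices vanish. -/
def ConstOnSlices {β : Type} (f : Coord → β) : Prop :=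
  ∀ x ∈ M.U, ∀ y ∈ M.U, M.Ω x = M.Ω y → f x = f y

/-- The Christoffel symbols `Γ^γ_{αβ}` of the Levi-Civita connection. -/
def christoffel (γ α β : Fin 4) (x : Coord) : ℝ :=
  (1 / 2) * ∑ δ, (M.g x)⁻¹ γ δ *
    (pd α (fun y => M.g y δ β) x + pd β (fun y => M.g y δ α) x - pd δ (fun y => M.g y α β) x)

/-- The covariant derivative `∇_α n_β`. -/
def nablaNormal (α β : Fin 4) (x : Coord) : ℝ :=
  pd α (fun y => M.normalLow y β) x - ∑ γ, M.christoffel γ α β x * M.normalLow x γ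

/-- The second fundamental form `χ(u, w)` of the slices, on vectors tangent to them. -/
def secondForm (x : Coord) (u w : Coord) : ℝ :=
  ∑ α, ∑ β, u α * w β * M.nablaNormal α β x

/-- The vector `σ` is tangent to the slice through `x` and orthogonal to the Killing vectors. -/
def Transverse (x σ : Coord) : Prop :=
  ip M.g x σ (M.normal x) = 0 ∧ ∀ a, ip M.g x (M.κ a x) σ = 0

/-- The Killing charges `q_a = g(κ_a, p)` of a momentum `p` at `x`. -/
def charge (x p : Coord) : Fin 2 → ℝ := fun a => ip M.g x (M.κ a x) p

end FoliatedSpacetime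

/-- The data of a slice-reducible (exact or conformal) Killing tensor
`K = α g + γ^{ab} κ_a κ_b + e^Ψ n n` generated by the foliation: the second fundamental form of the
slices is block diagonal and umbilic on the directions orthogonal to the Killing vectors,
`Ψ = ln φ² + Ψ̃` where `Ψ̃` is constant on slices with `n(Ψ̃) = 2 (χ_τ - n(ln φ))`, and
`γ^{ab} = e^Ψ G^{ab} + ν^{ab}` is constant on slices where `ν^{ab}` is constant along the normals. -/
structure SliceReducible (M : FoliatedSpacetime) where
  χτ : Coord → ℝ
  ΨTilde : Coord → ℝ
  γ : Coord → Matrix (Fin 2) (Fin 2) ℝ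
  smooth_ΨTilde : ContDiffOn ℝ ∞ ΨTilde M.U
  smooth_γ : ∀ a b, ContDiffOn ℝ ∞ (fun x => γ x a b) M.U
  block_mixed : ∀ x ∈ M.U, ∀ a σ, M.Transverse x σ → M.secondForm x (M.κ a x) σ = 0
  block_umbilic : ∀ x ∈ M.U, ∀ σ σ', M.Transverse x σ → M.Transverse x σ' →
    M.secondForm x σ σ' = χτ x * ip M.g x σ σ'
  ΨTilde_slice : M.ConstOnSlices ΨTilde
  ΨTilde_normal : ∀ x ∈ M.U, M.normalDeriv ΨTilde x =
    2 * (χτ x - M.normalDeriv (fun y => Real.log (M.lapse y)) x)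
  γ_slice : M.ConstOnSlices γ
  γ_normal : ∀ x ∈ M.U, ∀ a b, M.normalDeriv (fun y => γ y a b -
    Real.exp (Real.log (M.lapse y ^ 2) + ΨTilde y) * (M.gram y)⁻¹ a b) x = 0

/-- The scalar `Ψ = ln φ² + Ψ̃`. -/
def SliceReducible.Ψ {M : FoliatedSpacetime} (K : SliceReducible M) (x : Coord) : ℝ :=
  Real.log (M.lapse x ^ 2) + K.ΨTilde x

/-- A (possibly variable) mass function `m ≥ 0` that is invariant under the Killing flows and keeps
the Killing tensor symmetry of the motion: the derivative `(e^Ψ m²)'` is constant on slices, that is,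
it is the derivative of a function `μ` that is constant on slices.
For constant `m` and an exact Killing tensor with coefficient `α` of the metric, `α + e^Ψ` is constant
along the normals and `μ = -α m²`. -/
structure SeparableMass {M : FoliatedSpacetime} (K : SliceReducible M) where
  m : Coord → ℝ
  μ : Coord → ℝ
  nonneg : ∀ x ∈ M.U, 0 ≤ m x
  smooth_sq : ContDiffOn ℝ ∞ (fun x => m x ^ 2) M.U
  smooth_μ : ContDiffOn ℝ ∞ μ M.U
  invariant : ∀ a, ∀ x ∈ M.U, fderiv ℝ (fun y => m y ^ 2) x (M.κ a x) = 0
  μ_slice : M.ConstOnSlices μ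
  μ_normal : ∀ x ∈ M.U, M.normalDeriv (fun y => μ y - Real.exp (K.Ψ y) * m y ^ 2) x = 0

/-- Massless particles. -/
def massless {M : FoliatedSpacetime} (K : SliceReducible M) : SeparableMass K where
  m := fun _ => 0
  μ := fun _ => 0
  nonneg := fun _ _ => le_rfl
  smooth_sq := contDiffOn_const
  smooth_μ := contDiffOn_const
  invariant := by intro a x _; simp
  μ_slice := fun _ _ _ _ _ => rfl
  μ_normal := by intro x _; simp [FoliatedSpacetime.normalDeriv]

/-- The Carter constant of a particle of mass `m` with momentum `p` at `x`,
`γ^{ab} q_a q_b + e^Ψ g(n, p)² + μ`. For constant `m` and an exact Killing tensor `K` it equals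
`K(p, p)` on the mass shell `g(p, p) = -m²`. -/
def carter {M : FoliatedSpacetime} (K : SliceReducible M) (μ : Coord → ℝ) (x p : Coord) : ℝ :=
  M.charge x p ⬝ᵥ (K.γ x *ᵥ M.charge x p)
    + Real.exp (K.Ψ x) * (ip M.g x (M.normal x) p) ^ 2 + μ x

/-- The equation `(e^Ψ G^{ab})' q_a q_b + (e^Ψ m²)' = 0` which says that the slice through `x` is a
massive particle surface for particles of mass `m` with Killing charges `q`. -/
def IsMassiveParticleSurfaceAt {M : FoliatedSpacetime} (K : SliceReducible M) (m : Coord → ℝ)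
    (q : Fin 2 → ℝ) (x : Coord) : Prop :=
  ∑ a, ∑ b, M.prime (fun y => Real.exp (K.Ψ y) * (M.gram y)⁻¹ a b) x * q a * q b
    + M.prime (fun y => Real.exp (K.Ψ y) * m y ^ 2) x = 0

/-- `c` is the integral curve of the normal field, parametrized by the foliation parameter, that
extends from slices `Ω > a` to infinity. -/
structure IsNormalLine (M : FoliatedSpacetime) (a : ℝ) (c : ℝ → Coord) : Prop where
  mem : ∀ s, a < s → c s ∈ M.U
  param : ∀ s, a < s → M.Ω (c s) = s
  deriv : ∀ s, a < s → HasDerivAt c (M.lapse (c s) • M.normal (c s)) s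

/-- Along the normal line `c` the metric tends to the flat metric in spherical coordinates
`(t, φ, r, θ)` with `κ 0 = ∂_t`, `κ 1 = ∂_φ`: the polar angle `θ` labels the normal lines, and
`G_tt → -1`, `G_φφ ∼ r² sin² θ`, `g^θθ ∼ r⁻²`. The finite limit `-N` of `G_tφ` is zero in the
absence of a gravimagnetic mass. -/
structure AsymptoticallySpherical (M : FoliatedSpacetime) (a : ℝ) (c : ℝ → Coord)
    (r θ : Coord → ℝ) (N : ℝ) : Prop where
  smooth_θ : ContDiffOn ℝ ∞ θ M.U
  θ_killing : ∀ i, ∀ x ∈ M.U, M.κ i x ⬝ᵥ differential θ x = 0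
  θ_normal : ∀ x ∈ M.U, M.normalDeriv θ x = 0
  θ_mem : ∀ s, a < s → θ (c s) ∈ Set.Ioo 0 Real.pi
  r_tendsto : Tendsto (fun s => r (c s)) atTop atTop
  gram_tt : Tendsto (fun s => M.gram (c s) 0 0) atTop (𝓝 (-1))
  gram_tφ : Tendsto (fun s => M.gram (c s) 0 1) atTop (𝓝 (-N))
  gram_φφ : Tendsto (fun s => M.gram (c s) 1 1 / (r (c s) ^ 2 * Real.sin (θ (c s)) ^ 2)) atTop (𝓝 1)
  coip_θ : Tendsto (fun s => r (c s) ^ 2 *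
    coip M.g (c s) (differential θ (c s)) (differential θ (c s))) atTop (𝓝 1)

/-- `ε_{ab}` with `ε_{01} = 1`. -/
def epsLow : Matrix (Fin 2) (Fin 2) ℝ := !![0, 1; -1, 0]

/-- `ε^{ab}` with `ε^{01} = -1`. -/
def epsUp : Matrix (Fin 2) (Fin 2) ℝ := !![0, -1; 1, 0]

namespace FoliatedSpacetime

variable (M : FoliatedSpacetime)

/-- The norm `√(-G_{ab} v^a v^b)` of the velocity `v^a κ_a`. -/
def speed (x : Coord) (v : Fin 2 → ℝ) : ℝ := Real.sqrt (-(v ⬝ᵥ (M.gram x *ᵥ v)))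

/-- `√(-det G_{ab})`. -/
def sqrtDet (x : Coord) : ℝ := Real.sqrt (-(M.gram x).det)

/-- `τ^a = G^{ab} E_{bc} v^c` with `E_{ab} = √(-det G) ε_{ab}`. -/
def tau (x : Coord) (v : Fin 2 → ℝ) : Fin 2 → ℝ :=
  (M.gram x)⁻¹ *ᵥ ((M.sqrtDet x • epsLow) *ᵥ v)

/-- The tangent vector `v^a κ_a`. -/
def killingVec (x : Coord) (v : Fin 2 → ℝ) : Coord := ∑ a, v a • M.κ a x

/-- The tetrad vector `e_0` of the observer with velocity `v^a κ_a`. -/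
def e0 (x : Coord) (v : Fin 2 → ℝ) : Coord := (M.speed x v)⁻¹ • M.killingVec x v

/-- The tetrad vector `e_1` of the observer with velocity `v^a κ_a`. -/
def e1 (x : Coord) (v : Fin 2 → ℝ) : Coord := (M.speed x v)⁻¹ • M.killingVec x (M.tau x v)

/-- The tetrad vector `e_3`, pointing to the zenith, towards the gravitating object. -/
def e3 (x : Coord) : Coord := -M.normal x

/-- The momentum of a particle of mass `mass` and observable energy `E` in the direction of the
celestial sphere with azimuth `Φ` and altitude `Θ`. -/
def momentum (x : Coord) (v : Fin 2 → ℝ) (e2 : Coord) (E mass Φ Θ : ℝ) : Coord :=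
  (E / M.speed x v) • M.e0 x v + Real.sqrt ((E / M.speed x v) ^ 2 - mass ^ 2) •
    ((Real.sin Φ * Real.sin Θ) • M.e1 x v + (Real.cos Φ * Real.sin Θ) • e2
      + Real.cos Θ • M.e3 x)

end FoliatedSpacetime

/-- A family of stationary observers along the normal line `c`: the observer on the slice `Ω = s` is
at `c s`, has the timelike velocity `v^a κ_a`, and completes the tetrad by a unit vector `e2`. -/
structure Observer (M : FoliatedSpacetime) (a : ℝ) (c : ℝ → Coord) where
  v : ℝ → Fin 2 → ℝ
  e2 : ℝ → Coord
  timelike : ∀ s, a < s → v s ⬝ᵥ (M.gram (c s) *ᵥ v s) < 0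
  e2_transverse : ∀ s, a < s → M.Transverse (c s) (e2 s)
  e2_unit : ∀ s, a < s → ip M.g (c s) (e2 s) (e2 s) = 1

/-- Stereographic coordinates on the celestial sphere. -/
def stereoX (Φ Θ : ℝ) : ℝ := -2 * Real.tan (Θ / 2) * Real.sin Φ

/-- Stereographic coordinates on the celestial sphere. -/
def stereoY (Φ Θ : ℝ) : ℝ := -2 * Real.tan (Θ / 2) * Real.cos Φ

/-- The direction `(Φ, Θ)` in the hemisphere of the zenith belongs to the shadow boundary seen by the
observer at `x` with velocity `v^a κ_a`, and corresponds to the slice `Ω = Ω₀` and the future directed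
impact parameter vector `ρ`: the particle captured from this direction with energy `E` has the Killing
charges `q_a = -E ρ_a / (v^b ρ_b)`, and it has the same Killing charges and Carter constant as a
particle moving tangentially to the massive particle surface `Ω = Ω₀`. -/
structure IsShadowBoundary {M : FoliatedSpacetime} (K : SliceReducible M) (mass : SeparableMass K)
    (x : Coord) (v : Fin 2 → ℝ) (e2 : Coord) (E Ω₀ : ℝ) (ρ : Fin 2 → ℝ) (Φ Θ : ℝ) : Prop where
  altitude : Θ ∈ Set.Icc 0 (Real.pi / 2)
  energy : mass.m x * M.speed x v ≤ E
  future : v ⬝ᵥ ρ < 0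
  impact : M.charge x (M.momentum x v e2 E (mass.m x) Φ Θ) = (-E / (v ⬝ᵥ ρ)) • ρ
  touch : ∃ y ∈ M.U, M.Ω y = Ω₀ ∧ ∃ p : Coord,
    ip M.g y (M.normal y) p = 0 ∧ ip M.g y p p = -(mass.m y) ^ 2 ∧
    M.charge y p = M.charge x (M.momentum x v e2 E (mass.m x) Φ Θ) ∧
    IsMassiveParticleSurfaceAt K mass.m (M.charge y p) y ∧
    carter K mass.μ y p = carter K mass.μ x (M.momentum x v e2 E (mass.m x) Φ Θ)

/-- `m_E² = v² m² / E²`, where `v` is the norm of the velocity of the observer. -/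
def energyMassSq (v m E : ℝ) : ℝ := v ^ 2 * m ^ 2 / E ^ 2

/-- The shadow matrix `S^{ab} = e^Ψ (G^{ab} + m_E² v^a v^b / v²)` at `x` for an observer with velocity
components `v` of norm `vn`. -/
def shadowMatrix {M : FoliatedSpacetime} (K : SliceReducible M) (m : Coord → ℝ)
    (v : Fin 2 → ℝ) (vn E : ℝ) (x : Coord) : Matrix (Fin 2) (Fin 2) ℝ :=
  Real.exp (K.Ψ x) • ((M.gram x)⁻¹ + (energyMassSq vn (m x) E / vn ^ 2) • vecMulVec v v)

/-- The derivative `(S^{ab})'` of the shadow matrix (the observer is not differentiated). -/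
def shadowMatrixPrime {M : FoliatedSpacetime} (K : SliceReducible M) (m : Coord → ℝ)
    (v : Fin 2 → ℝ) (vn E : ℝ) (x : Coord) : Matrix (Fin 2) (Fin 2) ℝ :=
  Matrix.of fun a b => M.prime (fun y => shadowMatrix K m v vn E y a b) x

/-- `B^{ab} ρ_a ρ_b`. -/
def quad (B : Matrix (Fin 2) (Fin 2) ℝ) (ρ : Fin 2 → ℝ) : ℝ := ρ ⬝ᵥ (B *ᵥ ρ)

/-- The norm of the limiting velocity with contravariant components `vInf` and covariant
components `vLowInf`. -/
def speedInf (vInf vLowInf : Fin 2 → ℝ) : ℝ := Real.sqrt (-(vInf ⬝ᵥ vLowInf))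

/-- The limiting shadow matrix `S_∞^{ab} = e^Ψ (G^{ab} + m_{E∞}² v_∞^a v_∞^b / v_∞²)` at `x`, for the
limits `vInf`, `vLowInf` of the contravariant and covariant velocity components of the observer. -/
def SInf {M : FoliatedSpacetime} (K : SliceReducible M) (m : Coord → ℝ)
    (vInf vLowInf : Fin 2 → ℝ) (E : ℝ) (x : Coord) : Matrix (Fin 2) (Fin 2) ℝ :=
  shadowMatrix K m vInf (speedInf vInf vLowInf) E x

/-- The derivative `(S_∞^{ab})'`. -/
def SInfPrime {M : FoliatedSpacetime} (K : SliceReducible M) (m : Coord → ℝ)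
    (vInf vLowInf : Fin 2 → ℝ) (E : ℝ) (x : Coord) : Matrix (Fin 2) (Fin 2) ℝ :=
  Matrix.of fun a b => M.prime (fun y => SInf K m vInf vLowInf E y a b) x

/-- The mass term `e^Ψ m_{E∞}²` of `S_∞` at `x`. -/
def massTerm {M : FoliatedSpacetime} (K : SliceReducible M) (m : Coord → ℝ)
    (vInf vLowInf : Fin 2 → ℝ) (E : ℝ) (x : Coord) : ℝ :=
  Real.exp (K.Ψ x) * energyMassSq (speedInf vInf vLowInf) (m x) E

/-- `X_∞ = α_∞ (τ_∞^a ρ_a) / (√(1 - m_E²) (v_∞^a ρ_a))` with `τ_∞^a = ε^{ab} v_b`. -/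
def XInf (α : ℝ) (vInf vLowInf : Fin 2 → ℝ) (mE2 : ℝ) (ρ : Fin 2 → ℝ) : ℝ :=
  α * ((epsUp *ᵥ vLowInf) ⬝ᵥ ρ) / (Real.sqrt (1 - mE2) * (vInf ⬝ᵥ ρ))

/-- `Y_∞ = sgn · v_∞ √(-S_∞^{ab} ρ_a ρ_b) / (√(1 - m_E²) (v_∞^a ρ_a))`, where `sgn = ± 1`. -/
def YInf (sgn : ℝ) (S : Matrix (Fin 2) (Fin 2) ℝ) (vInf vLowInf : Fin 2 → ℝ) (mE2 : ℝ)
    (ρ : Fin 2 → ℝ) : ℝ :=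
  sgn * (speedInf vInf vLowInf * Real.sqrt (-quad S ρ)
    / (Real.sqrt (1 - mE2) * (vInf ⬝ᵥ ρ)))

end Shadow

end

/-! A shadow point is described by three scalar equations, whose limit is elementary once the growth
of `e^Ψ` and of the Gram determinant is known.

Growth. The gradient of `θ` is tangent to the slices and orthogonal to the Killing fields, so
umbilicity gives `n(|dθ|²) = -2 χ_τ |dθ|²` (`normalDeriv_coip`), while the equation for `Ψ̃` gives
`n(Ψ) = 2 χ_τ` (`normalDeriv_Ψ`). Hence `e^Ψ g^θθ` is constant along a normal line and `e^Ψ ∼ C r²`.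
Since `-det G ∼ r² sin² θ`, the ratio `α` converges. As `G_φφ` diverges while the covariant velocity
stays bounded, the limiting velocity has only a time component (`limit_velocity`).

Equations. Along a normal line `γ^{ab}` differs from `e^Ψ G^{ab}`, and `μ` from `e^Ψ m²`, by
constants. Equality of the Carter constants therefore says that `e^Ψ` times the negative of the
squared `e_2` momentum of the observed particle equals `e^Ψ (G^{ab} q_a q_b + m²)` on the slice
`Ω₀`, that is, the shadow matrix evaluated on `ρ`, up to a factor. The charges fix `sin Φ sin Θ`
through `τ^a ρ_a`. The surface equation holds anywhere on the slice iff it holds at `c Ω₀`, because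
`γ` and `μ` are constant on slices. This is `isShadowBoundary_iff`.

Limit. Multiplied by `e^{Ψ/2}`, both projections of the direction converge, so `Θ → 0` and
stereographic coordinates become these projections up to sign (`tendsto_stereo`). Conversely, small
prescribed projections lie in the unit disc and are realised by a direction. Solutions `ρ^∞` extend
to nearby equations because an isotropic vector of a nondegenerate indefinite binary form is stable
under perturbation (`exists_tendsto_isotropic`). Scaling holds because the mass enters the limiting
matrices only through `massTerm` and its derivative, and otherwise only the factor `√(1 - m_E²)`. -/

namespace Shadow

/-! ### Calculus of vector and matrix valued functions, entry by entry. -/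

theorem differentiableAt_det {n : ℕ} {E : Type*} [NormedAddCommGroup E] [NormedSpace ℝ E]
    {A : E → Matrix (Fin n) (Fin n) ℝ} {x : E}
    (hA : ∀ i j, DifferentiableAt ℝ (fun y => A y i j) x) :
    DifferentiableAt ℝ (fun y => (A y).det) x := by
  simp only [Matrix.det_apply]
  refine DifferentiableAt.fun_sum fun σ _ => ?_
  refine DifferentiableAt.fun_const_smul ?_ _
  exact (HasFDerivAt.finsetProd fun i _ => (hA (σ i) i).hasFDerivAt).differentiableAt

/-- Cramer's rule: an entry of the inverse is a quotient of determinants, in the numerator of which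
one row is replaced by a constant basis vector. -/
theorem differentiableAt_inv_entry {n : ℕ} {E : Type*} [NormedAddCommGroup E] [NormedSpace ℝ E]
    {A : E → Matrix (Fin n) (Fin n) ℝ} {x : E}
    (hA : ∀ i j, DifferentiableAt ℝ (fun y => A y i j) x) (hdet : (A x).det ≠ 0) (i j : Fin n) :
    DifferentiableAt ℝ (fun y => (A y)⁻¹ i j) x := by
  simp only [Matrix.inv_def, Matrix.smul_apply, Ring.inverse_eq_inv', smul_eq_mul,
    Matrix.adjugate_apply]
  refine ((differentiableAt_det hA).fun_inv hdet).fun_mul (differentiableAt_det fun k l => ?_)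
  by_cases hk : k = j
  · subst hk
    simp
  · simpa [Matrix.updateRow_ne hk] using hA k l

theorem differentiableAt_mulVec {n : ℕ} {E : Type*} [NormedAddCommGroup E] [NormedSpace ℝ E]
    {A : E → Matrix (Fin n) (Fin n) ℝ} {u : E → Fin n → ℝ} {x : E}
    (hA : ∀ i j, DifferentiableAt ℝ (fun y => A y i j) x)
    (hu : ∀ i, DifferentiableAt ℝ (fun y => u y i) x) (i : Fin n) :
    DifferentiableAt ℝ (fun y => (A y *ᵥ u y) i) x := by
  simp only [Matrix.mulVec, dotProduct]
  exact DifferentiableAt.fun_sum fun j _ => (hA i j).fun_mul (hu j)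

theorem differentiableAt_dotProduct {n : ℕ} {E : Type*} [NormedAddCommGroup E] [NormedSpace ℝ E]
    {u w : E → Fin n → ℝ} {x : E} (hu : ∀ i, DifferentiableAt ℝ (fun y => u y i) x)
    (hw : ∀ i, DifferentiableAt ℝ (fun y => w y i) x) :
    DifferentiableAt ℝ (fun y => u y ⬝ᵥ w y) x := by
  simp only [dotProduct]
  exact DifferentiableAt.fun_sum fun j _ => (hu j).fun_mul (hw j)

/-- The directional derivative of a scalar product of two vector valued functions. -/
theorem fderiv_dotProduct {n : ℕ} {E : Type*} [NormedAddCommGroup E] [NormedSpace ℝ E]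
    {u w : E → Fin n → ℝ} {x : E} (hu : ∀ i, DifferentiableAt ℝ (fun y => u y i) x)
    (hw : ∀ i, DifferentiableAt ℝ (fun y => w y i) x) (d : E) :
    fderiv ℝ (fun y => u y ⬝ᵥ w y) x d
      = (fun i => fderiv ℝ (fun y => u y i) x d) ⬝ᵥ w x
        + u x ⬝ᵥ (fun i => fderiv ℝ (fun y => w y i) x d) := by
  simp only [dotProduct]
  rw [fderiv_fun_sum fun j _ => (hu j).fun_mul (hw j), _root_.sum_apply,
    ← Finset.sum_add_distrib]
  refine Finset.sum_congr rfl fun j _ => ?_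
  rw [fderiv_fun_mul (hu j) (hw j)]
  simp
  ring

/-- The directional derivative of a matrix applied to a vector. -/
theorem fderiv_mulVec {n : ℕ} {E : Type*} [NormedAddCommGroup E] [NormedSpace ℝ E]
    {A : E → Matrix (Fin n) (Fin n) ℝ} {u : E → Fin n → ℝ} {x : E}
    (hA : ∀ i j, DifferentiableAt ℝ (fun y => A y i j) x)
    (hu : ∀ i, DifferentiableAt ℝ (fun y => u y i) x) (d : E) :
    (fun i => fderiv ℝ (fun y => (A y *ᵥ u y) i) x d)
      = (Matrix.of fun i j => fderiv ℝ (fun y => A y i j) x d) *ᵥ u x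
        + A x *ᵥ (fun i => fderiv ℝ (fun y => u y i) x d) := by
  funext i
  exact fderiv_dotProduct (hA i) hu d

theorem sum_pd (f : Coord → ℝ) (x u : Coord) : ∑ μ, u μ * pd μ f x = fderiv ℝ f x u := by
  conv_rhs => rw [show u = ∑ μ, u μ • (Pi.single μ 1 : Coord) by
    simpa using (pi_eq_sum_univ' u)]
  simp [pd, map_sum]

theorem dotProduct_differential (f : Coord → ℝ) (x u : Coord) :
    u ⬝ᵥ differential f x = fderiv ℝ f x u := sum_pd f x u

theorem differentiableAt_of_contDiffOn {U : Set Coord} (hU : IsOpen U) {f : Coord → ℝ}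
    (hf : ContDiffOn ℝ ∞ f U) {x : Coord} (hx : x ∈ U) : DifferentiableAt ℝ f x :=
  (hf.contDiffAt (hU.mem_nhds hx)).differentiableAt (by simp)

theorem differentiableAt_pd {U : Set Coord} (hU : IsOpen U) {f : Coord → ℝ}
    (hf : ContDiffOn ℝ ∞ f U) {x : Coord} (hx : x ∈ U) (μ : Fin 4) :
    DifferentiableAt ℝ (pd μ f) x := by
  have h : ContDiffAt ℝ 1 (fderiv ℝ f) x :=
    (hf.contDiffAt (hU.mem_nhds hx)).fderiv_right (by norm_cast)
  exact (h.differentiableAt (by simp)).clm_apply (differentiableAt_const _)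

/-- Symmetry of the second derivatives, contracted with two vectors. -/
theorem dotProduct_fderiv_differential_comm {U : Set Coord} (hU : IsOpen U) {f : Coord → ℝ}
    (hf : ContDiffOn ℝ ∞ f U) {x : Coord} (hx : x ∈ U) (u w : Coord) :
    u ⬝ᵥ (fun i => fderiv ℝ (fun y => differential f y i) x w)
      = w ⬝ᵥ (fun i => fderiv ℝ (fun y => differential f y i) x u) := by
  have hc := hf.contDiffAt (hU.mem_nhds hx)
  have h : ContDiffAt ℝ 1 (fderiv ℝ f) x := hc.fderiv_right (by norm_cast)
  have key : ∀ u w : Coord, u ⬝ᵥ (fun i => fderiv ℝ (fun y => differential f y i) x w)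
      = fderiv ℝ (fderiv ℝ f) x w u := by
    intro u w
    have : ∀ i, fderiv ℝ (fun y => differential f y i) x w
        = fderiv ℝ (fderiv ℝ f) x w (Pi.single i 1) := by
      intro i
      change fderiv ℝ (fun y => fderiv ℝ f y (Pi.single i 1)) x w = _
      rw [fderiv_clm_apply (h.differentiableAt (by simp)) (differentiableAt_const _)]
      simp
    simp only [this]
    conv_rhs => rw [show u = ∑ μ, u μ • (Pi.single μ 1 : Coord) by
      simpa using (pi_eq_sum_univ' u)]
    simp [map_sum, dotProduct]
  rw [key, key]
  have hs : IsSymmSndFDerivAt ℝ f x := hc.isSymmSndFDerivAt (by simp; norm_cast)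
  exact hs w u

/-! ### Geometry of the foliation: lapse, normal, second fundamental form. -/

namespace FoliatedSpacetime

variable (M : FoliatedSpacetime) {x : Coord}

theorem differentiableAt_g (hx : x ∈ M.U) (α β : Fin 4) :
    DifferentiableAt ℝ (fun y => M.g y α β) x :=
  differentiableAt_of_contDiffOn M.isOpen_U (M.smooth_g α β) hx

theorem differentiableAt_κ (hx : x ∈ M.U) (i : Fin 2) (α : Fin 4) :
    DifferentiableAt ℝ (fun y => M.κ i y α) x :=
  differentiableAt_of_contDiffOn M.isOpen_U (M.smooth_κ i α) hx

theorem det_g_ne_zero (hx : x ∈ M.U) : (M.g x).det ≠ 0 := by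
  obtain ⟨P, -, h⟩ := M.lorentzian x hx
  intro h0
  have := congrArg Matrix.det h
  rw [Matrix.det_mul, Matrix.det_mul, h0, Matrix.det_diagonal, Fin.prod_univ_four] at this
  simp at this

theorem g_mulVec_inv (hx : x ∈ M.U) (p : Coord) : M.g x *ᵥ ((M.g x)⁻¹ *ᵥ p) = p := by
  rw [Matrix.mulVec_mulVec, Matrix.mul_nonsing_inv _ (M.det_g_ne_zero hx).isUnit,
    Matrix.one_mulVec]

theorem ip_comm (hx : x ∈ M.U) (u w : Coord) : ip M.g x u w = ip M.g x w u := by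
  unfold ip
  rw [Matrix.dotProduct_mulVec, ← Matrix.mulVec_transpose, M.symm_g x hx, dotProduct_comm]

theorem differentiableAt_ginv (hx : x ∈ M.U) (α β : Fin 4) :
    DifferentiableAt ℝ (fun y => (M.g y)⁻¹ α β) x :=
  differentiableAt_inv_entry (M.differentiableAt_g hx) (M.det_g_ne_zero hx) α β

theorem differentiableAt_differential {f : Coord → ℝ} (hf : ContDiffOn ℝ ∞ f M.U) (hx : x ∈ M.U)
    (i : Fin 4) : DifferentiableAt ℝ (fun y => differential f y i) x :=
  differentiableAt_pd M.isOpen_U hf hx i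

theorem differentiableAt_coip {f : Coord → ℝ} (hf : ContDiffOn ℝ ∞ f M.U) (hx : x ∈ M.U) :
    DifferentiableAt ℝ (fun y => coip M.g y (differential f y) (differential f y)) x :=
  differentiableAt_dotProduct (M.differentiableAt_differential hf hx)
    (differentiableAt_mulVec (M.differentiableAt_ginv hx) (M.differentiableAt_differential hf hx))

theorem lapse_pos (hx : x ∈ M.U) : 0 < M.lapse x :=
  one_div_pos.2 (Real.sqrt_pos.2 (M.slice_timelike x hx))

theorem lapse_sq_mul_coip (hx : x ∈ M.U) :
    M.lapse x ^ 2 * coip M.g x (differential M.Ω x) (differential M.Ω x) = 1 := by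
  have h := M.slice_timelike x hx
  unfold lapse
  rw [div_pow, Real.sq_sqrt h.le]
  field_simp

theorem differentiableAt_lapse (hx : x ∈ M.U) : DifferentiableAt ℝ M.lapse x := by
  have h := M.slice_timelike x hx
  have h1 := (M.differentiableAt_coip M.smooth_Ω hx).sqrt h.ne'
  have h2 := h1.fun_inv (Real.sqrt_pos.2 h).ne'
  simp only [← one_div] at h2
  exact h2

theorem differentiableAt_normalLow (hx : x ∈ M.U) (i : Fin 4) :
    DifferentiableAt ℝ (fun y => M.normalLow y i) x :=
  (M.differentiableAt_lapse hx).fun_mul (M.differentiableAt_differential M.smooth_Ω hx i)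

theorem differentiableAt_normal (hx : x ∈ M.U) (i : Fin 4) :
    DifferentiableAt ℝ (fun y => M.normal y i) x :=
  differentiableAt_mulVec (M.differentiableAt_ginv hx) (M.differentiableAt_normalLow hx) i

theorem g_mulVec_normal (hx : x ∈ M.U) : M.g x *ᵥ M.normal x = M.normalLow x :=
  M.g_mulVec_inv hx _

theorem ip_normal_right (hx : x ∈ M.U) (u : Coord) :
    ip M.g x u (M.normal x) = M.lapse x * (u ⬝ᵥ differential M.Ω x) := by
  simp [ip, M.g_mulVec_normal hx, normalLow]

theorem lapse_mul_normal_dotProduct (hx : x ∈ M.U) :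
    M.lapse x * (M.normal x ⬝ᵥ differential M.Ω x) = 1 := by
  have h := M.lapse_sq_mul_coip hx
  rw [← h, normal, normalLow, dotProduct_comm, Matrix.mulVec_smul, dotProduct_smul, coip]
  simp only [smul_eq_mul]
  ring

theorem ip_normal_self (hx : x ∈ M.U) : ip M.g x (M.normal x) (M.normal x) = 1 := by
  rw [M.ip_normal_right hx, M.lapse_mul_normal_dotProduct hx]

theorem ip_κ_normal (hx : x ∈ M.U) (i : Fin 2) : ip M.g x (M.κ i x) (M.normal x) = 0 := by
  rw [M.ip_normal_right hx, M.killing_tangent i x hx, mul_zero]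

/-- This normalisation is what makes the prime a derivative with respect to `Ω`. -/
theorem prime_Ω (hx : x ∈ M.U) : M.prime M.Ω x = 1 := by
  rw [prime, normalDeriv, ← dotProduct_differential, M.lapse_mul_normal_dotProduct hx]

theorem prime_eq_fderiv (f : Coord → ℝ) (x : Coord) :
    M.prime f x = fderiv ℝ f x (M.lapse x • M.normal x) := by
  simp [prime, normalDeriv]

theorem differentiableAt_gram (hx : x ∈ M.U) (i j : Fin 2) :
    DifferentiableAt ℝ (fun y => M.gram y i j) x :=
  differentiableAt_dotProduct (M.differentiableAt_κ hx i)
    (differentiableAt_mulVec (M.differentiableAt_g hx) (M.differentiableAt_κ hx j))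

theorem det_gram_neg (hx : x ∈ M.U) : (M.gram x).det < 0 := M.gram_signature x hx

theorem gram_comm (hx : x ∈ M.U) (i j : Fin 2) : M.gram x i j = M.gram x j i :=
  M.ip_comm hx _ _

theorem differentiableAt_gram_inv (hx : x ∈ M.U) (i j : Fin 2) :
    DifferentiableAt ℝ (fun y => (M.gram y)⁻¹ i j) x :=
  differentiableAt_inv_entry (M.differentiableAt_gram hx) (M.det_gram_neg hx).ne i j

/-- The second fundamental form in terms of the derivatives of the conormal and the metric. -/
theorem secondForm_eq (hx : x ∈ M.U) (u : Coord) :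
    M.secondForm x u u = u ⬝ᵥ (fun β => fderiv ℝ (fun y => M.normalLow y β) x u)
      - M.normal x ⬝ᵥ ((Matrix.of fun δ β => fderiv ℝ (fun y => M.g y δ β) x u) *ᵥ u)
      + 1 / 2 * (u ⬝ᵥ
        ((Matrix.of fun α β => fderiv ℝ (fun y => M.g y α β) x (M.normal x)) *ᵥ u)) := by
  have hsymm : ∀ γ δ, (M.g x)⁻¹ γ δ = (M.g x)⁻¹ δ γ := by
    intro γ δ
    have : ((M.g x)⁻¹)ᵀ = (M.g x)⁻¹ := by rw [Matrix.transpose_nonsing_inv, M.symm_g x hx]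
    exact congrFun (congrFun this δ) γ
  -- Contracting the Christoffel symbol with the conormal raises the index back to the normal
  -- vector, and the inverse metric disappears.
  have hchr : ∀ α β, ∑ γ, M.christoffel γ α β x * M.normalLow x γ = 1 / 2 * ∑ δ, M.normal x δ *
      (pd α (fun y => M.g y δ β) x + pd β (fun y => M.g y δ α) x
        - pd δ (fun y => M.g y α β) x) := by
    intro α β
    simp only [christoffel, normal, Matrix.mulVec, dotProduct, Finset.mul_sum, Finset.sum_mul]
    rw [Finset.sum_comm]
    refine Finset.sum_congr rfl fun δ _ => Finset.sum_congr rfl fun γ _ => ?_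
    rw [hsymm γ δ]
    ring
  simp only [secondForm, nablaNormal, hchr, ← sum_pd, dotProduct, Matrix.mulVec, Matrix.of_apply]
  generalize M.normal x = n
  generalize (fun α β => pd α (fun y => M.normalLow y β) x) = A
  simp only [Fin.sum_univ_four]
  ring

/-- Along the normals, the squared norm of the differential of a function that is constant along
normals and Killing orbits changes by the umbilicity factor of the slices. -/
theorem normalDeriv_coip (K : SliceReducible M) {θ : Coord → ℝ} (hθ : ContDiffOn ℝ ∞ θ M.U)
    (hκ : ∀ i, ∀ x ∈ M.U, M.κ i x ⬝ᵥ differential θ x = 0)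
    (hn : ∀ x ∈ M.U, M.normalDeriv θ x = 0) (hx : x ∈ M.U) :
    M.normalDeriv (fun y => coip M.g y (differential θ y) (differential θ y)) x
      = -2 * K.χτ x * coip M.g x (differential θ x) (differential θ x) := by
  set σ : Coord → Coord := fun y => (M.g y)⁻¹ *ᵥ differential θ y with hσ
  have hgσ : ∀ y ∈ M.U, M.g y *ᵥ σ y = differential θ y := fun y hy => M.g_mulVec_inv hy _
  have hcoip : ∀ y, coip M.g y (differential θ y) (differential θ y) = differential θ y ⬝ᵥ σ y :=
    fun y => rfl
  have dθ := M.differentiableAt_differential hθ hx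
  have dσ : ∀ i, DifferentiableAt ℝ (fun y => σ y i) x :=
    differentiableAt_mulVec (M.differentiableAt_ginv hx) dθ
  have dn := M.differentiableAt_normal hx
  have dg := M.differentiableAt_g hx
  have hU := M.isOpen_U.mem_nhds hx
  -- `σ` is the gradient of `θ`; the two assumptions on `θ` say exactly that it is a direction in
  -- which the slice is umbilic.
  have htr : M.Transverse x (σ x) := by
    constructor
    · rw [M.ip_comm hx, ip, hgσ x hx, dotProduct_differential]
      exact hn x hx
    · intro i
      rw [ip, hgσ x hx]
      exact hκ i x hx
  have hχ : M.secondForm x (σ x) (σ x)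
      = K.χτ x * coip M.g x (differential θ x) (differential θ x) := by
    rw [K.block_umbilic x hx _ _ htr htr, ip, hgσ x hx, hcoip, dotProduct_comm]
  have hDθ : ∀ d, (fun i => fderiv ℝ (fun y => differential θ y i) x d)
      = (Matrix.of fun i j => fderiv ℝ (fun y => M.g y i j) x d) *ᵥ σ x
        + M.g x *ᵥ (fun i => fderiv ℝ (fun y => σ y i) x d) := by
    intro d
    rw [← fderiv_mulVec dg dσ]
    funext i
    have : (fun y => differential θ y i) =ᶠ[𝓝 x] fun y => (M.g y *ᵥ σ y) i := by
      filter_upwards [hU] with y hy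
      rw [hgσ y hy]
    rw [this.fderiv_eq]
  have hDn : ∀ d, (fun i => fderiv ℝ (fun y => M.normalLow y i) x d)
      = (Matrix.of fun i j => fderiv ℝ (fun y => M.g y i j) x d) *ᵥ M.normal x
        + M.g x *ᵥ (fun i => fderiv ℝ (fun y => M.normal y i) x d) := by
    intro d
    rw [← fderiv_mulVec dg dn]
    funext i
    have : (fun y => M.normalLow y i) =ᶠ[𝓝 x] fun y => (M.g y *ᵥ M.normal y) i := by
      filter_upwards [hU] with y hy
      rw [M.g_mulVec_normal hy]
    rw [this.fderiv_eq]
  have hnθ : ∀ d, (fun i => fderiv ℝ (fun y => M.normal y i) x d) ⬝ᵥ differential θ x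
      + M.normal x ⬝ᵥ (fun i => fderiv ℝ (fun y => differential θ y i) x d) = 0 := by
    intro d
    rw [← fderiv_dotProduct dn dθ]
    have : (fun y => M.normal y ⬝ᵥ differential θ y) =ᶠ[𝓝 x] fun _ => (0 : ℝ) := by
      filter_upwards [hU] with y hy
      rw [dotProduct_differential]
      exact hn y hy
    rw [this.fderiv_eq]
    simp
  have hself : ∀ u w : Coord, u ⬝ᵥ (M.g x *ᵥ w) = w ⬝ᵥ (M.g x *ᵥ u) := fun u w => M.ip_comm hx u w
  have hgsym : ∀ d, ∀ u w : Coord,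
      u ⬝ᵥ ((Matrix.of fun i j => fderiv ℝ (fun y => M.g y i j) x d) *ᵥ w)
        = w ⬝ᵥ ((Matrix.of fun i j => fderiv ℝ (fun y => M.g y i j) x d) *ᵥ u) := by
    intro d u w
    have hs : ∀ i j, fderiv ℝ (fun y => M.g y i j) x = fderiv ℝ (fun y => M.g y j i) x := by
      intro i j
      have : (fun y => M.g y i j) =ᶠ[𝓝 x] fun y => M.g y j i := by
        filter_upwards [hU] with y hy
        exact congrFun (congrFun (M.symm_g y hy) j) i
      exact this.fderiv_eq
    simp only [dotProduct, Matrix.mulVec, Matrix.of_apply, Finset.mul_sum]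
    rw [Finset.sum_comm]
    refine Finset.sum_congr rfl fun i _ => Finset.sum_congr rfl fun j _ => ?_
    rw [hs]
    ring
  have hmain : M.normalDeriv (fun y => coip M.g y (differential θ y) (differential θ y)) x
      = (fun i => fderiv ℝ (fun y => differential θ y i) x (M.normal x)) ⬝ᵥ σ x
        + differential θ x ⬝ᵥ (fun i => fderiv ℝ (fun y => σ y i) x (M.normal x)) :=
    fderiv_dotProduct dθ dσ (M.normal x)
  -- The rest is linear algebra. Differentiating `g σ = dθ` along `n`, `g n = n♭` along `σ`, and `n
  -- · dθ = 0` along `σ`, and using the symmetry of the Hessian of `θ`, both `-2 χ(σ, σ)` and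
  -- `n(|dθ|²)` become `2 σ · ∂_n dθ - σ · (∂_n g) σ`.
  have e1 := congrArg (fun z => σ x ⬝ᵥ z) (hDθ (M.normal x))
  have e2 := congrArg (fun z => σ x ⬝ᵥ z) (hDn (σ x))
  have e3 := dotProduct_fderiv_differential_comm M.isOpen_U hθ hx (σ x) (M.normal x)
  have e4 := hnθ (σ x)
  have e5 := M.secondForm_eq hx (σ x)
  simp only [dotProduct_add] at e1 e2
  rw [hself (σ x), hgσ x hx] at e1 e2
  rw [hgsym (σ x) (σ x)] at e2
  rw [hmain, mul_assoc, ← hχ, dotProduct_comm _ (σ x), dotProduct_comm (differential θ x)]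
  linarith

end FoliatedSpacetime

variable {M : FoliatedSpacetime} (K : SliceReducible M) {x : Coord}

theorem SliceReducible.differentiableAt_Ψ (hx : x ∈ M.U) : DifferentiableAt ℝ K.Ψ x :=
  (((M.differentiableAt_lapse hx).fun_pow 2).log (pow_pos (M.lapse_pos hx) 2).ne').fun_add
    (differentiableAt_of_contDiffOn M.isOpen_U K.smooth_ΨTilde hx)

/-- The two contributions of `n(ln φ)` cancel. What remains is the negative of the logarithmic rate
of `|dθ|²`. -/
theorem SliceReducible.normalDeriv_Ψ (hx : x ∈ M.U) : M.normalDeriv K.Ψ x = 2 * K.χτ x := by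
  have hl := M.differentiableAt_lapse hx
  have h1 : (fun y => Real.log (M.lapse y ^ 2)) = fun y => 2 * Real.log (M.lapse y) := by
    funext y
    simp [Real.log_pow]
  have h2 := K.ΨTilde_normal x hx
  have hlog := hl.log (M.lapse_pos hx).ne'
  have : K.Ψ = fun y => 2 * Real.log (M.lapse y) + K.ΨTilde y := by
    funext y
    exact congrArg (· + K.ΨTilde y) (congrFun h1 y)
  rw [this, FoliatedSpacetime.normalDeriv, fderiv_fun_add (hlog.const_mul 2)
    (differentiableAt_of_contDiffOn M.isOpen_U K.smooth_ΨTilde hx),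
    _root_.add_apply, fderiv_const_mul hlog]
  simp only [FoliatedSpacetime.normalDeriv] at h2
  simp only [_root_.smul_apply, smul_eq_mul, h2]
  ring

end Shadow
namespace Shadow

theorem quad_fin_two (B : Matrix (Fin 2) (Fin 2) ℝ) (ρ : Fin 2 → ℝ) :
    quad B ρ = B 0 0 * ρ 0 ^ 2 + (B 0 1 + B 1 0) * ρ 0 * ρ 1 + B 1 1 * ρ 1 ^ 2 := by
  simp [quad, dotProduct, Matrix.mulVec, Fin.sum_univ_two]
  ring

theorem quad_smul (B : Matrix (Fin 2) (Fin 2) ℝ) (k : ℝ) (ρ : Fin 2 → ℝ) :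
    quad B (k • ρ) = k ^ 2 * quad B ρ := by
  simp [quad_fin_two]
  ring

/-! ### Functions along the normal line and the growth of `e^Ψ` and `det G`. -/

section NormalLine

variable {M : FoliatedSpacetime} {a : ℝ} {c : ℝ → Coord}

theorem IsNormalLine.hasDerivAt_comp (hc : IsNormalLine M a c) {f : Coord → ℝ} {s : ℝ}
    (hs : a < s) (hf : DifferentiableAt ℝ f (c s)) :
    HasDerivAt (fun t => f (c t)) (M.prime f (c s)) s := by
  rw [M.prime_eq_fderiv]
  exact hf.hasFDerivAt.comp_hasDerivAt s (hc.deriv s hs)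

theorem IsNormalLine.eq_of_normalDeriv_eq_zero (hc : IsNormalLine M a c) {f : Coord → ℝ}
    (hf : ∀ x ∈ M.U, DifferentiableAt ℝ f x) (h0 : ∀ x ∈ M.U, M.normalDeriv f x = 0)
    {s t : ℝ} (hs : a < s) (ht : a < t) : f (c s) = f (c t) := by
  have hd : ∀ u ∈ Set.Ioi a, HasDerivAt (fun t => f (c t)) 0 u := by
    intro u hu
    have := hc.hasDerivAt_comp hu (hf _ (hc.mem u hu))
    rwa [FoliatedSpacetime.prime, h0 _ (hc.mem u hu), mul_zero] at this
  exact isOpen_Ioi.is_const_of_deriv_eq_zero isPreconnected_Ioi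
    (fun u hu => (hd u hu).differentiableAt.differentiableWithinAt)
    (fun u hu => (hd u hu).deriv) hs ht

/-- The derivative `f'` of a function that is constant on slices is constant on slices. -/
theorem IsNormalLine.prime_eq_of_constOnSlices (hc : IsNormalLine M a c) {f : Coord → ℝ}
    (hf : M.ConstOnSlices f) {y : Coord} (hy : y ∈ M.U) (ha : a < M.Ω y)
    (hd : DifferentiableAt ℝ f (c (M.Ω y))) :
    M.prime f y = M.prime f (c (M.Ω y)) := by
  have hΩ := differentiableAt_of_contDiffOn M.isOpen_U M.smooth_Ω hy
  -- Near `y` the function factors through `Ω`, with the normal line as a section of `Ω`; the chain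
  -- rule and `Ω' = 1` then give the claim.
  have hev : f =ᶠ[𝓝 y] fun z => f (c (M.Ω z)) := by
    filter_upwards [M.isOpen_U.mem_nhds hy, hΩ.continuousAt.eventually (lt_mem_nhds ha)]
      with z hz hz'
    exact hf z hz _ (hc.mem _ hz') (hc.param _ hz').symm
  have h1 := (hc.hasDerivAt_comp ha hd).comp_hasFDerivAt y hΩ.hasFDerivAt
  have h2 : fderiv ℝ f y = M.prime f (c (M.Ω y)) • fderiv ℝ M.Ω y :=
    hev.fderiv_eq.trans h1.fderiv
  have h3 := M.prime_Ω hy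
  rw [M.prime_eq_fderiv] at h3 ⊢
  rw [h2, _root_.smul_apply, h3, smul_eq_mul, mul_one]

/-- The factor `e^Ψ` is inversely proportional to `g^θθ` along the normals. -/
theorem IsNormalLine.exp_Ψ_mul_coip_eq (hc : IsNormalLine M a c) (K : SliceReducible M)
    {r θ : Coord → ℝ} {N : ℝ} (hflat : AsymptoticallySpherical M a c r θ N) {s t : ℝ}
    (hs : a < s) (ht : a < t) :
    Real.exp (K.Ψ (c s)) * coip M.g (c s) (differential θ (c s)) (differential θ (c s))
      = Real.exp (K.Ψ (c t)) * coip M.g (c t) (differential θ (c t)) (differential θ (c t)) := by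
  have hdΨ : ∀ x ∈ M.U, DifferentiableAt ℝ (fun y => Real.exp (K.Ψ y)) x := fun x hx =>
    (K.differentiableAt_Ψ hx).exp
  have hdw := fun (x : Coord) (hx : x ∈ M.U) => M.differentiableAt_coip hflat.smooth_θ hx
  refine hc.eq_of_normalDeriv_eq_zero (f := fun y => Real.exp (K.Ψ y) *
    coip M.g y (differential θ y) (differential θ y))
    (fun x hx => (hdΨ x hx).fun_mul (hdw x hx)) (fun x hx => ?_) hs ht
  have h1 := M.normalDeriv_coip K hflat.smooth_θ hflat.θ_killing hflat.θ_normal hx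
  have h2 := K.normalDeriv_Ψ hx
  unfold FoliatedSpacetime.normalDeriv at h1 h2 ⊢
  rw [fderiv_fun_mul (hdΨ x hx) (hdw x hx), fderiv_exp (K.differentiableAt_Ψ hx)]
  simp only [_root_.add_apply, _root_.smul_apply, smul_eq_mul, h1, h2]
  ring

variable {r θ : Coord → ℝ} {N : ℝ}

theorem IsNormalLine.θ_eq (hc : IsNormalLine M a c) (hflat : AsymptoticallySpherical M a c r θ N)
    {s t : ℝ} (hs : a < s) (ht : a < t) : θ (c s) = θ (c t) :=
  hc.eq_of_normalDeriv_eq_zero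
    (fun _ hx => differentiableAt_of_contDiffOn M.isOpen_U hflat.smooth_θ hx) hflat.θ_normal hs ht

theorem IsNormalLine.tendsto_gram_φφ_div (hc : IsNormalLine M a c)
    (hflat : AsymptoticallySpherical M a c r θ N) {t : ℝ} (ht : a < t) :
    Tendsto (fun s => M.gram (c s) 1 1 / r (c s) ^ 2) atTop (𝓝 (Real.sin (θ (c t)) ^ 2)) := by
  have hsin : 0 < Real.sin (θ (c t)) := Real.sin_pos_of_mem_Ioo (hflat.θ_mem t ht)
  have h := hflat.gram_φφ.mul_const (Real.sin (θ (c t)) ^ 2)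
  rw [one_mul] at h
  refine h.congr' ?_
  filter_upwards [eventually_gt_atTop a] with s hs
  rw [hc.θ_eq hflat hs ht]
  field_simp

theorem AsymptoticallySpherical.tendsto_sq (hflat : AsymptoticallySpherical M a c r θ N) :
    Tendsto (fun s => r (c s) ^ 2) atTop atTop :=
  (tendsto_pow_atTop two_ne_zero).comp hflat.r_tendsto

theorem IsNormalLine.tendsto_gram_φφ (hc : IsNormalLine M a c)
    (hflat : AsymptoticallySpherical M a c r θ N) :
    Tendsto (fun s => M.gram (c s) 1 1) atTop atTop := by
  have ht : a < a + 1 := by linarith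
  have hsin : 0 < Real.sin (θ (c (a + 1))) := Real.sin_pos_of_mem_Ioo (hflat.θ_mem _ ht)
  have h := hflat.tendsto_sq.atTop_mul_pos (pow_pos hsin 2) (hc.tendsto_gram_φφ_div hflat ht)
  refine h.congr' ?_
  filter_upwards [hflat.r_tendsto.eventually_gt_atTop 0] with s hs
  field_simp

/-- `e^Ψ ∼ C r²` along the normal line. -/
theorem IsNormalLine.exists_tendsto_exp_Ψ_div (hc : IsNormalLine M a c) (K : SliceReducible M)
    (hflat : AsymptoticallySpherical M a c r θ N) :
    ∃ C : ℝ, 0 < C ∧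
      Tendsto (fun s => Real.exp (K.Ψ (c s)) / r (c s) ^ 2) atTop (𝓝 C) := by
  have ht : a < a + 1 := by linarith
  -- The point `a + 1` is an arbitrary reference point of the line.
  set C := Real.exp (K.Ψ (c (a + 1))) * coip M.g (c (a + 1)) (differential θ (c (a + 1)))
    (differential θ (c (a + 1))) with hC
  have hconst : ∀ s, a < s → Real.exp (K.Ψ (c s)) *
      coip M.g (c s) (differential θ (c s)) (differential θ (c s)) = C :=
    fun s hs => hc.exp_Ψ_mul_coip_eq K hflat hs ht
  have hpos : ∀ᶠ s in atTop, 0 < r (c s) ^ 2 *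
      coip M.g (c s) (differential θ (c s)) (differential θ (c s)) :=
    hflat.coip_θ.eventually (lt_mem_nhds one_pos)
  refine ⟨C, ?_, ?_⟩
  -- The sign of the constant is read off far out, where `r² |dθ|²` is close to `1`.
  · obtain ⟨s, hs, hsa, hr⟩ := (hpos.and ((eventually_gt_atTop a).and
      (hflat.r_tendsto.eventually_gt_atTop 0))).exists
    rw [← hconst s hsa]
    exact mul_pos (Real.exp_pos _) (pos_of_mul_pos_right hs (pow_pos hr 2).le)
  · have h := (tendsto_const_nhds (x := C)).div hflat.coip_θ one_ne_zero
    rw [div_one] at h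
    refine h.congr' ?_
    filter_upwards [hpos, eventually_gt_atTop a, hflat.r_tendsto.eventually_gt_atTop 0]
      with s hs hsa hr
    have hw : coip M.g (c s) (differential θ (c s)) (differential θ (c s)) ≠ 0 :=
      (pos_of_mul_pos_right hs (pow_pos hr 2).le).ne'
    rw [← hconst s hsa]
    simp only [Pi.div_apply]
    field_simp

theorem IsNormalLine.tendsto_Ψ (hc : IsNormalLine M a c) (K : SliceReducible M)
    (hflat : AsymptoticallySpherical M a c r θ N) :
    Tendsto (fun s => K.Ψ (c s)) atTop atTop := by
  obtain ⟨C, hC, h⟩ := hc.exists_tendsto_exp_Ψ_div K hflat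
  have h2 : Tendsto (fun s => Real.exp (K.Ψ (c s))) atTop atTop := by
    refine (hflat.tendsto_sq.atTop_mul_pos hC h).congr' ?_
    filter_upwards [hflat.r_tendsto.eventually_gt_atTop 0] with s hs
    field_simp
  exact Real.tendsto_exp_comp_atTop.1 h2

/-- The ratio `e^{Ψ/2} / √(-det G)` has a finite positive limit. -/
theorem IsNormalLine.exists_tendsto_exp_div_sqrtDet (hc : IsNormalLine M a c)
    (K : SliceReducible M) (hflat : AsymptoticallySpherical M a c r θ N) :
    ∃ α : ℝ, 0 < α ∧
      Tendsto (fun s => Real.exp (K.Ψ (c s) / 2) / M.sqrtDet (c s)) atTop (𝓝 α) := by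
  obtain ⟨C, hC, h⟩ := hc.exists_tendsto_exp_Ψ_div K hflat
  have ht : a < a + 1 := by linarith
  have hsin : 0 < Real.sin (θ (c (a + 1))) := Real.sin_pos_of_mem_Ioo (hflat.θ_mem _ ht)
  set S := Real.sin (θ (c (a + 1))) ^ 2 with hS
  have hSpos : 0 < S := pow_pos hsin 2
  -- In `-det G = -G_tt G_φφ + G_tφ²` the last term is bounded, so it is lost after division by
  -- `r²`; a NUT charge does not matter.
  have hdet : Tendsto (fun s => -(M.gram (c s)).det / r (c s) ^ 2) atTop (𝓝 S) := by
    have h1 := (hflat.gram_tt.neg.mul (hc.tendsto_gram_φφ_div hflat ht)).add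
      ((hflat.gram_tφ.pow 2).mul hflat.tendsto_sq.inv_tendsto_atTop)
    simp only [neg_neg, one_mul, mul_zero, add_zero] at h1
    refine h1.congr' ?_
    filter_upwards [eventually_gt_atTop a, hflat.r_tendsto.eventually_gt_atTop 0] with s hs hr
    rw [Matrix.det_fin_two, M.gram_comm (hc.mem s hs) 1 0]
    simp only [Pi.inv_apply]
    field_simp
    ring
  refine ⟨Real.sqrt (C / S), Real.sqrt_pos.2 (div_pos hC hSpos), ?_⟩
  refine ((Real.continuous_sqrt.tendsto _).comp (h.div hdet hSpos.ne')).congr' ?_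
  filter_upwards [eventually_gt_atTop a, hflat.r_tendsto.eventually_gt_atTop 0] with s hs hr
  have hd := M.det_gram_neg (hc.mem s hs)
  have h2 : Real.exp (K.Ψ (c s) / 2) = Real.sqrt (Real.exp (K.Ψ (c s))) := by
    rw [← Real.exp_half]
  simp only [Function.comp_apply, Pi.div_apply, FoliatedSpacetime.sqrtDet]
  rw [div_div_div_cancel_right₀ (pow_pos hr 2).ne', Real.sqrt_div (Real.exp_pos _).le, h2]

end NormalLine

/-- In the limit of the distant observer the velocity has no angular component, and its covariant
time component is opposite to the contravariant one. -/
theorem limit_velocity {M : FoliatedSpacetime} {a : ℝ} {c : ℝ → Coord} (hc : IsNormalLine M a c)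
    {r θ : Coord → ℝ} {N : ℝ} (hflat : AsymptoticallySpherical M a c r θ N)
    {v : ℝ → Fin 2 → ℝ} {vInf vLowInf : Fin 2 → ℝ} (hv : Tendsto v atTop (𝓝 vInf))
    (hvLow : Tendsto (fun s => M.gram (c s) *ᵥ v s) atTop (𝓝 vLowInf)) :
    vInf 1 = 0 ∧ vLowInf 0 = -vInf 0 := by
  have hv' := tendsto_pi_nhds.1 hv
  have hw := tendsto_pi_nhds.1 hvLow
  simp only [Matrix.mulVec, dotProduct, Fin.sum_univ_two] at hw
  have hG := hc.tendsto_gram_φφ hflat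
  -- The angular component is `(v_φ - G_tφ v^t) / G_φφ`, with convergent numerator and divergent
  -- denominator.
  have h1 : vInf 1 = 0 := by
    have h := ((hw 1).sub (hflat.gram_tφ.mul (hv' 0))).mul hG.inv_tendsto_atTop
    rw [mul_zero] at h
    refine tendsto_nhds_unique (hv' 1) (h.congr' ?_)
    filter_upwards [eventually_gt_atTop a, hG.eventually_gt_atTop 0] with s hs hpos
    rw [M.gram_comm (hc.mem s hs) 1 0]
    simp only [Pi.inv_apply]
    field_simp
    ring
  refine ⟨h1, ?_⟩
  have h := (hflat.gram_tt.mul (hv' 0)).add (hflat.gram_tφ.mul (hv' 1))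
  rw [tendsto_nhds_unique (hw 0) h, h1]
  ring

theorem speedInf_eq {vInf vLowInf : Fin 2 → ℝ} (h : vInf 1 = 0 ∧ vLowInf 0 = -vInf 0) :
    speedInf vInf vLowInf = |vInf 0| := by
  simp [speedInf, dotProduct, Fin.sum_univ_two, h.1, h.2, Real.sqrt_mul_self_eq_abs]

/-- The limit of timelike velocities could a priori be null or zero. As only the time component
survives, a nonzero pairing with some `ρ` excludes this. -/
theorem speedInf_pos {vInf vLowInf ρ : Fin 2 → ℝ} (h : vInf 1 = 0 ∧ vLowInf 0 = -vInf 0)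
    (hρ : vInf ⬝ᵥ ρ < 0) : 0 < speedInf vInf vLowInf := by
  rw [speedInf_eq h, abs_pos]
  intro h0
  simp [dotProduct, Fin.sum_univ_two, h.1, h0] at hρ

/-! ### Algebra of the Killing plane: the velocity, `τ` and the decomposition of charges. -/

namespace FoliatedSpacetime

variable (M : FoliatedSpacetime) {x : Coord}

theorem tendsto_speed {l : Filter ℝ} {c : ℝ → Coord} {v : ℝ → Fin 2 → ℝ}
    {vInf vLowInf : Fin 2 → ℝ} (hv : Tendsto v l (𝓝 vInf))
    (hvLow : Tendsto (fun s => M.gram (c s) *ᵥ v s) l (𝓝 vLowInf)) :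
    Tendsto (fun s => M.speed (c s) (v s)) l (𝓝 (speedInf vInf vLowInf)) := by
  have hc : Continuous fun p : (Fin 2 → ℝ) × (Fin 2 → ℝ) => Real.sqrt (-(p.1 ⬝ᵥ p.2)) := by
    fun_prop
  exact (hc.tendsto (vInf, vLowInf)).comp (hv.prodMk_nhds hvLow)

theorem sqrtDet_sq (hx : x ∈ M.U) : M.sqrtDet x ^ 2 = -(M.gram x).det :=
  Real.sq_sqrt (by linarith [M.det_gram_neg hx])

theorem gram_inv_fin_two (x : Coord) : (M.gram x)⁻¹ = (M.gram x).det⁻¹ •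
    !![M.gram x 1 1, -M.gram x 0 1; -M.gram x 1 0, M.gram x 0 0] := by
  rw [Matrix.inv_def, Matrix.adjugate_fin_two, Ring.inverse_eq_inv']

/-- In dimension two the inverse is the adjugate over the determinant, and the adjugate is the
conjugate of `G` by `ε`. The right side involves only the covariant velocity, hence converges even
though `G` diverges. -/
theorem sqrtDet_smul_tau (hx : x ∈ M.U) (v : Fin 2 → ℝ) :
    M.sqrtDet x • M.tau x v = epsUp *ᵥ (M.gram x *ᵥ v) := by
  have hd := (M.det_gram_neg hx).ne
  have hs := M.sqrtDet_sq hx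
  have : M.sqrtDet x • M.tau x v = M.sqrtDet x ^ 2 • ((M.gram x)⁻¹ *ᵥ (epsLow *ᵥ v)) := by
    rw [tau, Matrix.smul_mulVec, Matrix.mulVec_smul, smul_smul, sq]
  rw [this, hs, gram_inv_fin_two]
  funext i
  fin_cases i <;>
    simp [Matrix.mulVec, dotProduct, Fin.sum_univ_two, epsLow, epsUp, M.gram_comm hx 1 0] <;>
    field_simp <;> ring

theorem gram_mulVec_tau (hx : x ∈ M.U) (v : Fin 2 → ℝ) :
    M.gram x *ᵥ M.tau x v = M.sqrtDet x • (epsLow *ᵥ v) := by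
  rw [tau, Matrix.mulVec_mulVec, Matrix.mul_nonsing_inv _ (M.det_gram_neg hx).ne.isUnit,
    Matrix.one_mulVec, Matrix.smul_mulVec]

theorem sqrtDet_pos (hx : x ∈ M.U) : 0 < M.sqrtDet x :=
  Real.sqrt_pos.2 (by linarith [M.det_gram_neg hx])

theorem tau_eq (hx : x ∈ M.U) (v : Fin 2 → ℝ) :
    M.tau x v = (M.sqrtDet x)⁻¹ • (epsUp *ᵥ (M.gram x *ᵥ v)) := by
  rw [← M.sqrtDet_smul_tau hx, smul_smul, inv_mul_cancel₀ (M.sqrtDet_pos hx).ne', one_smul]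

theorem dotProduct_gram_tau (hx : x ∈ M.U) (v : Fin 2 → ℝ) :
    v ⬝ᵥ (M.gram x *ᵥ M.tau x v) = 0 := by
  rw [M.gram_mulVec_tau hx]
  simp [dotProduct, Fin.sum_univ_two, epsLow]
  ring

theorem tau_dotProduct_gram (hx : x ∈ M.U) (v : Fin 2 → ℝ) :
    M.tau x v ⬝ᵥ (M.gram x *ᵥ v) = 0 := by
  rw [M.tau_eq hx]
  simp [Matrix.mulVec, dotProduct, Fin.sum_univ_two, epsUp]
  ring

/-- Together with `tau_dotProduct_gram_tau` this makes `(v, τ)` an orthogonal frame of the Killing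
plane with opposite squared norms, so that `e_1` is a unit vector. -/
theorem tau_dotProduct_gram_tau (hx : x ∈ M.U) (v : Fin 2 → ℝ) :
    M.tau x v ⬝ᵥ (M.gram x *ᵥ M.tau x v) = -(v ⬝ᵥ (M.gram x *ᵥ v)) := by
  rw [M.gram_mulVec_tau hx, M.tau_eq hx, smul_dotProduct, dotProduct_smul, smul_smul,
    inv_mul_cancel₀ (M.sqrtDet_pos hx).ne', one_smul]
  simp [Matrix.mulVec, dotProduct, Fin.sum_univ_two, epsUp, epsLow]
  ring

/-- Decomposition of a covector with respect to the velocity and its orthogonal complement. -/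
theorem neg_quad_smul_eq (hx : x ∈ M.U) (v ρ : Fin 2 → ℝ) :
    (-(v ⬝ᵥ (M.gram x *ᵥ v))) • ρ = (-(v ⬝ᵥ ρ)) • (M.gram x *ᵥ v)
      + (M.tau x v ⬝ᵥ ρ) • (M.gram x *ᵥ M.tau x v) := by
  rw [M.gram_mulVec_tau hx, M.tau_eq hx, smul_dotProduct, smul_smul, smul_eq_mul,
    mul_right_comm, inv_mul_cancel₀ (M.sqrtDet_pos hx).ne', one_mul]
  funext i
  fin_cases i <;>
    simp [Matrix.mulVec, dotProduct, Fin.sum_univ_two, epsUp, epsLow, M.gram_comm hx 1 0] <;>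
    ring

/-- This is the inverse Gram form written in the orthogonal frame `(v, τ)`. -/
theorem neg_quad_mul_quad_inv (hx : x ∈ M.U) (v ρ : Fin 2 → ℝ) :
    -(v ⬝ᵥ (M.gram x *ᵥ v)) * quad (M.gram x)⁻¹ ρ
      = -(v ⬝ᵥ ρ) ^ 2 + (M.tau x v ⬝ᵥ ρ) ^ 2 := by
  have hd := (M.det_gram_neg hx).ne
  have h2 : (M.tau x v ⬝ᵥ ρ) ^ 2
      = (-(M.gram x).det)⁻¹ * ((epsUp *ᵥ (M.gram x *ᵥ v)) ⬝ᵥ ρ) ^ 2 := by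
    rw [M.tau_eq hx, smul_dotProduct, smul_eq_mul, mul_pow, inv_pow, M.sqrtDet_sq hx]
  rw [h2, quad_fin_two, gram_inv_fin_two]
  have hdet := Matrix.det_fin_two (M.gram x)
  rw [M.gram_comm hx 1 0] at hdet
  simp [Matrix.mulVec, dotProduct, Fin.sum_univ_two, epsUp, M.gram_comm hx 1 0]
  field_simp
  rw [hdet]
  ring

end FoliatedSpacetime

end Shadow
namespace Shadow

/-! ### Charges and normal component of the observed momentum. -/

section Bilinear

variable (g : Coord → Matrix (Fin 4) (Fin 4) ℝ) (x : Coord)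

theorem ip_add_left (u v w : Coord) : ip g x (u + v) w = ip g x u w + ip g x v w :=
  add_dotProduct _ _ _

theorem ip_add_right (u v w : Coord) : ip g x u (v + w) = ip g x u v + ip g x u w := by
  simp [ip, Matrix.mulVec_add, dotProduct_add]

theorem ip_smul_left (k : ℝ) (u w : Coord) : ip g x (k • u) w = k * ip g x u w :=
  smul_dotProduct _ _ _

theorem ip_smul_right (k : ℝ) (u w : Coord) : ip g x u (k • w) = k * ip g x u w := by
  simp [ip, Matrix.mulVec_smul, dotProduct_smul]

theorem ip_neg_right (u w : Coord) : ip g x u (-w) = -ip g x u w := by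
  simp [ip, Matrix.mulVec_neg]

end Bilinear

namespace FoliatedSpacetime

variable (M : FoliatedSpacetime) {x : Coord}

theorem charge_add (u w : Coord) : M.charge x (u + w) = M.charge x u + M.charge x w := by
  funext i
  exact ip_add_right _ _ _ _ _

theorem charge_smul (k : ℝ) (u : Coord) : M.charge x (k • u) = k • M.charge x u := by
  funext i
  exact ip_smul_right _ _ _ _ _

theorem charge_killingVec (x : Coord) (v : Fin 2 → ℝ) :
    M.charge x (M.killingVec x v) = M.gram x *ᵥ v := by
  funext i
  simp [charge, killingVec, ip_add_right, ip_smul_right, Matrix.mulVec, dotProduct, gram, gramOf,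
    mul_comm]

theorem ip_killingVec_left (v : Fin 2 → ℝ) (p : Coord) :
    ip M.g x (M.killingVec x v) p = v ⬝ᵥ M.charge x p := by
  simp [charge, killingVec, ip_add_left, ip_smul_left, dotProduct]

theorem Transverse.charge_eq_zero {σ : Coord} (h : M.Transverse x σ) : M.charge x σ = 0 :=
  funext h.2

theorem charge_normal (hx : x ∈ M.U) : M.charge x (M.normal x) = 0 :=
  funext (M.ip_κ_normal hx)

theorem ip_normal_killingVec (hx : x ∈ M.U) (v : Fin 2 → ℝ) :
    ip M.g x (M.normal x) (M.killingVec x v) = 0 := by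
  rw [M.ip_comm hx, M.ip_killingVec_left, M.charge_normal hx, dotProduct_zero]

/-- The vectors `e_2` and `e_3` are orthogonal to the Killing fields, so the charges see only `e_0`
and `e_1`. -/
theorem charge_momentum (hx : x ∈ M.U) {e2 : Coord} (h2 : M.Transverse x e2) (v : Fin 2 → ℝ)
    (E mass Φ Θ : ℝ) :
    M.charge x (M.momentum x v e2 E mass Φ Θ) =
      (E / M.speed x v ^ 2) • (M.gram x *ᵥ v)
      + (Real.sqrt ((E / M.speed x v) ^ 2 - mass ^ 2) * (Real.sin Φ * Real.sin Θ)
        / M.speed x v) • (M.gram x *ᵥ M.tau x v) := by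
  have h3 : M.charge x (M.e3 x) = 0 := by
    rw [e3, ← neg_one_smul ℝ, charge_smul, M.charge_normal hx, smul_zero]
  simp only [momentum, charge_add, charge_smul, h3, Transverse.charge_eq_zero M h2, e0, e1,
    charge_killingVec, smul_zero, add_zero, smul_smul]
  congr 2
  · rw [div_eq_mul_inv, div_eq_mul_inv]
    ring
  · rw [div_eq_mul_inv]
    ring

theorem ip_normal_momentum (hx : x ∈ M.U) {e2 : Coord} (h2 : M.Transverse x e2) (v : Fin 2 → ℝ)
    (E mass Φ Θ : ℝ) :
    ip M.g x (M.normal x) (M.momentum x v e2 E mass Φ Θ) =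
      -(Real.sqrt ((E / M.speed x v) ^ 2 - mass ^ 2) * Real.cos Θ) := by
  simp only [momentum, e0, e1, e3, ip_add_right, ip_smul_right, ip_neg_right,
    M.ip_normal_killingVec hx, M.ip_normal_self hx, M.ip_comm hx (M.normal x) e2, h2.1]
  ring

/-- Existence of a momentum tangent to the slice with given charges and mass. -/
theorem exists_tangential_momentum (hx : x ∈ M.U) {e2 : Coord} (h2 : M.Transverse x e2)
    (h2u : ip M.g x e2 e2 = 1) {q : Fin 2 → ℝ} {m : ℝ}
    (hq : quad (M.gram x)⁻¹ q + m ^ 2 ≤ 0) :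
    ∃ p : Coord, ip M.g x (M.normal x) p = 0 ∧ ip M.g x p p = -m ^ 2 ∧ M.charge x p = q := by
  -- The charges fix the Killing part of the momentum; the component along `e2` is free and is used
  -- to reach the mass shell, which needs precisely the sign condition `hq`.
  set z := Real.sqrt (-(quad (M.gram x)⁻¹ q + m ^ 2)) with hz
  have hz2 : z ^ 2 = -(quad (M.gram x)⁻¹ q + m ^ 2) := Real.sq_sqrt (by linarith)
  have hch : M.charge x (M.killingVec x ((M.gram x)⁻¹ *ᵥ q) + z • e2) = q := by
    rw [charge_add, charge_smul, charge_killingVec, Transverse.charge_eq_zero M h2, smul_zero,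
      add_zero, Matrix.mulVec_mulVec, Matrix.mul_nonsing_inv _ (M.det_gram_neg hx).ne.isUnit,
      Matrix.one_mulVec]
  refine ⟨M.killingVec x ((M.gram x)⁻¹ *ᵥ q) + z • e2, ?_, ?_, hch⟩
  · rw [ip_add_right, ip_smul_right, M.ip_normal_killingVec hx, M.ip_comm hx, h2.1, mul_zero,
      add_zero]
  · rw [ip_add_left, ip_killingVec_left, hch, ip_smul_left, ip_add_right, ip_smul_right, h2u,
      M.ip_comm hx e2, ip_killingVec_left, Transverse.charge_eq_zero M h2, dotProduct_zero,
      dotProduct_comm]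
    have : quad (M.gram x)⁻¹ q = q ⬝ᵥ ((M.gram x)⁻¹ *ᵥ q) := rfl
    rw [← this]
    nlinarith [hz2]

end FoliatedSpacetime

/-! ### Transport of the surface equation along slices and of the Carter constant along the normal.
-/

variable {M : FoliatedSpacetime} {K : SliceReducible M} {x : Coord}

/-- `(e^Ψ G^{ab})'`. -/
noncomputable def gramPrime (K : SliceReducible M) (x : Coord) : Matrix (Fin 2) (Fin 2) ℝ :=
  Matrix.of fun i j => M.prime (fun y => Real.exp (K.Ψ y) * (M.gram y)⁻¹ i j) x

/-- `(e^Ψ m²)'`. -/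
noncomputable def massPrime (K : SliceReducible M) (m : Coord → ℝ) (x : Coord) : ℝ :=
  M.prime (fun y => Real.exp (K.Ψ y) * m y ^ 2) x

theorem SliceReducible.differentiableAt_exp_gram_inv (K : SliceReducible M) (hx : x ∈ M.U)
    (i j : Fin 2) : DifferentiableAt ℝ (fun y => Real.exp (K.Ψ y) * (M.gram y)⁻¹ i j) x :=
  (K.differentiableAt_Ψ hx).exp.fun_mul (M.differentiableAt_gram_inv hx i j)

theorem SeparableMass.differentiableAt_exp_sq (mass : SeparableMass K) (hx : x ∈ M.U) :
    DifferentiableAt ℝ (fun y => Real.exp (K.Ψ y) * mass.m y ^ 2) x :=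
  (K.differentiableAt_Ψ hx).exp.fun_mul
    (differentiableAt_of_contDiffOn M.isOpen_U mass.smooth_sq hx)

theorem prime_congr_of_normalDeriv_sub {f h : Coord → ℝ} (hf : DifferentiableAt ℝ f x)
    (hh : DifferentiableAt ℝ h x) (h0 : M.normalDeriv (fun y => f y - h y) x = 0) :
    M.prime h x = M.prime f x := by
  unfold FoliatedSpacetime.prime FoliatedSpacetime.normalDeriv at *
  rw [fderiv_fun_sub hf hh, _root_.sub_apply] at h0
  rw [sub_eq_zero.1 h0]

theorem isMassiveParticleSurfaceAt_iff {m : Coord → ℝ} {q : Fin 2 → ℝ} :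
    IsMassiveParticleSurfaceAt K m q x ↔ quad (gramPrime K x) q + massPrime K m x = 0 := by
  have : ∑ i, ∑ j, M.prime (fun y => Real.exp (K.Ψ y) * (M.gram y)⁻¹ i j) x * q i * q j
      = quad (gramPrime K x) q := by
    simp only [quad_fin_two, gramPrime, Fin.sum_univ_two, Matrix.of_apply]
    ring
  rw [IsMassiveParticleSurfaceAt, this, massPrime]

section NormalLine

variable {a : ℝ} {c : ℝ → Coord}

/-- The matrix `e^Ψ G^{ab}` may vary over a slice, but its prime equals that of `γ^{ab}`, which does
not. Thus the surface equation at an arbitrary point of the slice can be tested on the line `c`. For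
the mass term `μ` plays the role of `γ`. -/
theorem IsNormalLine.gramPrime_eq (hc : IsNormalLine M a c) (K : SliceReducible M) {y : Coord}
    (hy : y ∈ M.U) (ha : a < M.Ω y) : gramPrime K y = gramPrime K (c (M.Ω y)) := by
  ext i j
  have hγ : ∀ z ∈ M.U, DifferentiableAt ℝ (fun x => K.γ x i j) z := fun z hz =>
    differentiableAt_of_contDiffOn M.isOpen_U (K.smooth_γ i j) hz
  have hp : ∀ z ∈ M.U, gramPrime K z i j = M.prime (fun x => K.γ x i j) z := fun z hz =>
    prime_congr_of_normalDeriv_sub (hγ z hz) (K.differentiableAt_exp_gram_inv hz i j)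
      (K.γ_normal z hz i j)
  have hcU := hc.mem _ ha
  rw [hp y hy, hp _ hcU]
  exact hc.prime_eq_of_constOnSlices
    (fun u hu w hw h => congrFun (congrFun (K.γ_slice u hu w hw h) i) j) hy ha (hγ _ hcU)

theorem IsNormalLine.massPrime_eq (hc : IsNormalLine M a c) (mass : SeparableMass K) {y : Coord}
    (hy : y ∈ M.U) (ha : a < M.Ω y) : massPrime K mass.m y = massPrime K mass.m (c (M.Ω y)) := by
  have hμ : ∀ z ∈ M.U, DifferentiableAt ℝ mass.μ z := fun z hz =>
    differentiableAt_of_contDiffOn M.isOpen_U mass.smooth_μ hz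
  have hp : ∀ z ∈ M.U, massPrime K mass.m z = M.prime mass.μ z := fun z hz =>
    prime_congr_of_normalDeriv_sub (hμ z hz) (mass.differentiableAt_exp_sq hz)
      (mass.μ_normal z hz)
  have hcU := hc.mem _ ha
  rw [hp y hy, hp _ hcU]
  exact hc.prime_eq_of_constOnSlices mass.μ_slice hy ha (hμ _ hcU)

theorem IsNormalLine.quad_γ_sub (hc : IsNormalLine M a c) (K : SliceReducible M) {s t : ℝ}
    (hs : a < s) (ht : a < t) (q : Fin 2 → ℝ) :
    quad (K.γ (c s)) q - Real.exp (K.Ψ (c s)) * quad (M.gram (c s))⁻¹ q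
      = quad (K.γ (c t)) q - Real.exp (K.Ψ (c t)) * quad (M.gram (c t))⁻¹ q := by
  have h : ∀ i j, K.γ (c s) i j - Real.exp (K.Ψ (c s)) * (M.gram (c s))⁻¹ i j
      = K.γ (c t) i j - Real.exp (K.Ψ (c t)) * (M.gram (c t))⁻¹ i j := fun i j =>
    hc.eq_of_normalDeriv_eq_zero
      (f := fun y => K.γ y i j - Real.exp (K.Ψ y) * (M.gram y)⁻¹ i j)
      (fun _ hz => (differentiableAt_of_contDiffOn M.isOpen_U (K.smooth_γ i j) hz).fun_sub
        (K.differentiableAt_exp_gram_inv hz i j))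
      (fun _ hz => K.γ_normal _ hz i j) hs ht
  simp only [quad_fin_two]
  linear_combination q 0 ^ 2 * h 0 0 + q 0 * q 1 * h 0 1 + q 0 * q 1 * h 1 0 + q 1 ^ 2 * h 1 1

theorem IsNormalLine.μ_sub (hc : IsNormalLine M a c) (mass : SeparableMass K) {s t : ℝ}
    (hs : a < s) (ht : a < t) :
    mass.μ (c s) - Real.exp (K.Ψ (c s)) * mass.m (c s) ^ 2
      = mass.μ (c t) - Real.exp (K.Ψ (c t)) * mass.m (c t) ^ 2 :=
  hc.eq_of_normalDeriv_eq_zero (f := fun y => mass.μ y - Real.exp (K.Ψ y) * mass.m y ^ 2)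
    (fun _ hz => (differentiableAt_of_contDiffOn M.isOpen_U mass.smooth_μ hz).fun_sub
      (mass.differentiableAt_exp_sq hz)) mass.μ_normal hs ht

/-- Comparison of the Carter constants of a particle tangent to a slice and of a particle with the
same charges on the normal line. -/
theorem IsNormalLine.carter_eq_iff (hc : IsNormalLine M a c) (mass : SeparableMass K) {y p : Coord}
    (hy : y ∈ M.U) (ha : a < M.Ω y) (hp : ip M.g y (M.normal y) p = 0) {s : ℝ} (hs : a < s)
    {P : Coord} (hq : M.charge y p = M.charge (c s) P) :
    carter K mass.μ y p = carter K mass.μ (c s) P ↔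
      Real.exp (K.Ψ (c (M.Ω y))) * (quad (M.gram (c (M.Ω y)))⁻¹ (M.charge (c s) P)
          + mass.m (c (M.Ω y)) ^ 2)
        = Real.exp (K.Ψ (c s)) * (quad (M.gram (c s))⁻¹ (M.charge (c s) P)
          + mass.m (c s) ^ 2 + ip M.g (c s) (M.normal (c s)) P ^ 2) := by
  have hΩ : M.Ω y = M.Ω (c (M.Ω y)) := (hc.param _ ha).symm
  -- First `γ` and `μ` are moved within the slice of `y` to the line `c`; then their change along
  -- `c` is traded for that of `e^Ψ G^{ab}` and `e^Ψ m²`.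
  have h1 := hc.quad_γ_sub K hs ha (M.charge (c s) P)
  have h2 := hc.μ_sub mass hs ha
  have h3 : K.γ y = K.γ (c (M.Ω y)) := K.γ_slice y hy _ (hc.mem _ ha) hΩ
  have h4 : mass.μ y = mass.μ (c (M.Ω y)) := mass.μ_slice y hy _ (hc.mem _ ha) hΩ
  have h5 : ∀ z w, carter K mass.μ z w = quad (K.γ z) (M.charge z w)
      + Real.exp (K.Ψ z) * (ip M.g z (M.normal z) w) ^ 2 + mass.μ z := fun _ _ => rfl
  rw [h5, h5, hp, h3, h4, hq]
  constructor <;> intro h <;> linarith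

end NormalLine

/-! ### The shadow matrix and the exact equations for an observer at finite distance. -/

section ShadowMatrix

/-- The norm of the velocity cancels, so the shadow matrix depends on the observer only through the
components `v^a`. -/
theorem energyMassSq_div {vn : ℝ} (hvn : vn ≠ 0) (m E : ℝ) :
    energyMassSq vn m E / vn ^ 2 = m ^ 2 / E ^ 2 := by
  unfold energyMassSq
  field_simp

theorem shadowMatrix_apply (m : Coord → ℝ) (v : Fin 2 → ℝ) {vn : ℝ} (hvn : vn ≠ 0) (E : ℝ)
    (x : Coord) (i j : Fin 2) :
    shadowMatrix K m v vn E x i j = Real.exp (K.Ψ x) * (M.gram x)⁻¹ i j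
      + v i * v j / E ^ 2 * (Real.exp (K.Ψ x) * m x ^ 2) := by
  simp only [shadowMatrix, energyMassSq_div hvn, Matrix.smul_apply, Matrix.add_apply,
    Matrix.vecMulVec_apply, smul_eq_mul]
  ring

/-- For `q = -E ρ / (v · ρ)` this is `e^Ψ (G^{ab} q_a q_b + m²)` up to the factor `(v · ρ)² / E²`:
the shadow matrix makes the inhomogeneous mass shell expression homogeneous in `ρ`. -/
theorem quad_shadowMatrix (m : Coord → ℝ) (v : Fin 2 → ℝ) {vn : ℝ} (hvn : vn ≠ 0) (E : ℝ)
    (x : Coord) (ρ : Fin 2 → ℝ) :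
    quad (shadowMatrix K m v vn E x) ρ = Real.exp (K.Ψ x) *
      (quad (M.gram x)⁻¹ ρ + m x ^ 2 * (v ⬝ᵥ ρ) ^ 2 / E ^ 2) := by
  simp only [quad_fin_two, shadowMatrix_apply m v hvn, dotProduct, Fin.sum_univ_two]
  ring

theorem shadowMatrixPrime_apply (mass : SeparableMass K) (v : Fin 2 → ℝ) {vn : ℝ} (hvn : vn ≠ 0)
    (E : ℝ) (hx : x ∈ M.U) (i j : Fin 2) :
    shadowMatrixPrime K mass.m v vn E x i j = gramPrime K x i j
      + v i * v j / E ^ 2 * massPrime K mass.m x := by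
  have h : (fun y => shadowMatrix K mass.m v vn E y i j) = fun y =>
      Real.exp (K.Ψ y) * (M.gram y)⁻¹ i j
        + v i * v j / E ^ 2 * (Real.exp (K.Ψ y) * mass.m y ^ 2) :=
    funext fun y => shadowMatrix_apply mass.m v hvn E y i j
  have hd := mass.differentiableAt_exp_sq hx
  simp only [shadowMatrixPrime, gramPrime, massPrime, Matrix.of_apply, h, M.prime_eq_fderiv]
  rw [fderiv_fun_add (K.differentiableAt_exp_gram_inv hx i j) (hd.const_mul _),
    fderiv_const_mul hd]
  rfl

theorem quad_shadowMatrixPrime (mass : SeparableMass K) (v : Fin 2 → ℝ) {vn : ℝ} (hvn : vn ≠ 0)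
    (E : ℝ) (hx : x ∈ M.U) (ρ : Fin 2 → ℝ) :
    quad (shadowMatrixPrime K mass.m v vn E x) ρ = quad (gramPrime K x) ρ
      + (v ⬝ᵥ ρ) ^ 2 / E ^ 2 * massPrime K mass.m x := by
  simp only [quad_fin_two, shadowMatrixPrime_apply mass v hvn E hx, dotProduct, Fin.sum_univ_two]
  ring

end ShadowMatrix

/-- The equations of the shadow boundary for an observer at finite distance. -/
structure ShadowEquations (K : SliceReducible M) (mass : SeparableMass K) (x₀ x : Coord)
    (v : Fin 2 → ℝ) (E : ℝ) (ρ : Fin 2 → ℝ) (Φ Θ : ℝ) : Prop where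
  surface : quad (shadowMatrixPrime K mass.m v (M.speed x v) E x₀) ρ = 0
  sin_eq : Real.sqrt (1 - energyMassSq (M.speed x v) (mass.m x) E) * (Real.sin Φ * Real.sin Θ)
    = -(M.tau x v ⬝ᵥ ρ) / (v ⬝ᵥ ρ)
  cos_eq : Real.exp (K.Ψ x) * ((1 - energyMassSq (M.speed x v) (mass.m x) E) *
      (Real.cos Φ * Real.sin Θ) ^ 2)
    = -(M.speed x v ^ 2 * quad (shadowMatrix K mass.m v (M.speed x v) E x₀) ρ) / (v ⬝ᵥ ρ) ^ 2

/-- A direction belongs to the shadow boundary exactly if it solves the shadow equations. -/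
theorem isShadowBoundary_iff {a : ℝ} {c : ℝ → Coord} (hc : IsNormalLine M a c)
    (mass : SeparableMass K) {s Ω₀ : ℝ} (hs : a < s) (hΩ₀ : a < Ω₀) {v : Fin 2 → ℝ}
    (hv : v ⬝ᵥ (M.gram (c s) *ᵥ v) < 0) {e2 e2' : Coord} (h2 : M.Transverse (c s) e2)
    (h2' : M.Transverse (c Ω₀) e2') (h2u : ip M.g (c Ω₀) e2' e2' = 1) {E : ℝ} (hE : 0 < E)
    {ρ : Fin 2 → ℝ} {Φ Θ : ℝ} :
    IsShadowBoundary K mass (c s) v e2 E Ω₀ ρ Φ Θ ↔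
      Θ ∈ Set.Icc 0 (Real.pi / 2) ∧ mass.m (c s) * M.speed (c s) v ≤ E ∧ v ⬝ᵥ ρ < 0 ∧
        ShadowEquations K mass (c Ω₀) (c s) v E ρ Φ Θ := by
  have hx := hc.mem s hs
  have hx₀ := hc.mem Ω₀ hΩ₀
  set w := M.speed (c s) v with hw
  have hwpos : 0 < w := Real.sqrt_pos.2 (by linarith)
  have hw2 : w ^ 2 = -(v ⬝ᵥ (M.gram (c s) *ᵥ v)) := Real.sq_sqrt (by linarith)
  set P := M.momentum (c s) v e2 E (mass.m (c s)) Φ Θ with hP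
  set k := 1 - energyMassSq w (mass.m (c s)) E with hk
  have key : ∀ (_ : mass.m (c s) * w ≤ E), 0 ≤ k := by
    intro hen
    have h1 : 0 ≤ mass.m (c s) * w := mul_nonneg (mass.nonneg _ hx) hwpos.le
    have h2 : (mass.m (c s) * w) ^ 2 ≤ E ^ 2 := pow_le_pow_left₀ h1 hen 2
    rw [hk, energyMassSq, sub_nonneg, div_le_one (by positivity)]
    linarith
  have hR2 : (E / w) ^ 2 - mass.m (c s) ^ 2 = (E / w) ^ 2 * k := by
    rw [hk, energyMassSq]
    field_simp
  have hR : Real.sqrt ((E / w) ^ 2 - mass.m (c s) ^ 2) = E / w * Real.sqrt k := by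
    rw [hR2, Real.sqrt_mul (sq_nonneg _), Real.sqrt_sq (by positivity)]
  have hcharge := M.charge_momentum hx h2 v E (mass.m (c s)) Φ Θ
  rw [← hP, ← hw, hR] at hcharge
  have hnormal := M.ip_normal_momentum hx h2 v E (mass.m (c s)) Φ Θ
  rw [← hP, ← hw, hR] at hnormal
  -- the charges are those of the impact parameter vector
  have himpact : v ⬝ᵥ ρ < 0 → (M.charge (c s) P = (-E / (v ⬝ᵥ ρ)) • ρ ↔
      Real.sqrt k * (Real.sin Φ * Real.sin Θ) = -(M.tau (c s) v ⬝ᵥ ρ) / (v ⬝ᵥ ρ)) := by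
    intro hf
    have hne : v ⬝ᵥ ρ ≠ 0 := hf.ne
    have hdec := M.neg_quad_smul_eq hx v ρ
    rw [← hw2] at hdec
    constructor
    · intro h
      -- Pairing with `τ` removes the part along the velocity; the pairing with `v` only expresses
      -- that the energy is `E`.
      have h1 := congrArg (fun q => M.tau (c s) v ⬝ᵥ q) (hcharge.symm.trans h)
      simp only [dotProduct_add, dotProduct_smul, M.tau_dotProduct_gram hx,
        M.tau_dotProduct_gram_tau hx, ← hw2, smul_eq_mul] at h1
      have h2 : E / w * Real.sqrt k * (Real.sin Φ * Real.sin Θ) / w * w ^ 2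
          = E * (Real.sqrt k * (Real.sin Φ * Real.sin Θ)) := by
        field_simp
      refine mul_left_cancel₀ hE.ne' (h2.symm.trans ?_)
      linear_combination h1
    · intro h
      -- Conversely `ρ` is recovered from its two frame components, and they match the charges one
      -- by one.
      have h1 : ρ = (w ^ 2)⁻¹ • ((-(v ⬝ᵥ ρ)) • (M.gram (c s) *ᵥ v)
          + (M.tau (c s) v ⬝ᵥ ρ) • (M.gram (c s) *ᵥ M.tau (c s) v)) := by
        rw [← hdec, smul_smul, inv_mul_cancel₀ (by positivity), one_smul]
      have h2 : (-E / (v ⬝ᵥ ρ)) • ρ = (-E / (v ⬝ᵥ ρ)) • ((w ^ 2)⁻¹ • ((-(v ⬝ᵥ ρ)) •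
          (M.gram (c s) *ᵥ v) + (M.tau (c s) v ⬝ᵥ ρ) • (M.gram (c s) *ᵥ M.tau (c s) v))) :=
        congrArg (fun z => (-E / (v ⬝ᵥ ρ)) • z) h1
      rw [h2, hcharge, smul_add, smul_add, smul_smul, smul_smul, smul_smul, smul_smul]
      congr 2
      · field_simp
      · rw [mul_assoc (E / w), h]
        field_simp
  -- the radial equation
  have hcos : mass.m (c s) * w ≤ E → quad (M.gram (c s))⁻¹ (M.charge (c s) P)
      + mass.m (c s) ^ 2 + ip M.g (c s) (M.normal (c s)) P ^ 2
      = -((E / w) ^ 2 * k * (Real.cos Φ * Real.sin Θ) ^ 2) := by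
    intro hen
    have h1 := M.neg_quad_mul_quad_inv hx v (M.charge (c s) P)
    have hvq : v ⬝ᵥ M.charge (c s) P = -E := by
      rw [hcharge]
      simp only [dotProduct_add, dotProduct_smul, M.dotProduct_gram_tau hx, smul_eq_mul]
      rw [← neg_neg (v ⬝ᵥ _), ← hw2]
      field_simp
      ring
    have hτq : M.tau (c s) v ⬝ᵥ M.charge (c s) P
        = w * (E / w * Real.sqrt k * (Real.sin Φ * Real.sin Θ)) := by
      rw [hcharge]
      simp only [dotProduct_add, dotProduct_smul, M.tau_dotProduct_gram hx,
        M.tau_dotProduct_gram_tau hx, ← hw2, smul_eq_mul]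
      field_simp
      ring
    rw [← hw2, hvq, hτq] at h1
    have hsk := Real.sq_sqrt (key hen)
    have h1' : quad (M.gram (c s))⁻¹ (M.charge (c s) P) = -(E / w) ^ 2
        + (E / w) ^ 2 * k * (Real.sin Φ * Real.sin Θ) ^ 2 := by
      have : w ^ 2 * quad (M.gram (c s))⁻¹ (M.charge (c s) P) = w ^ 2 * (-(E / w) ^ 2
        + (E / w) ^ 2 * k * (Real.sin Φ * Real.sin Θ) ^ 2) := by
        have hEw : w * (E / w) = E := by field_simp
        linear_combination h1 + w ^ 2 * (E / w) ^ 2 * (Real.sin Φ * Real.sin Θ) ^ 2 * hsk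
          + (w * (E / w) + E) * hEw
      exact mul_left_cancel₀ (by positivity) this
    -- On the mass shell the `e_0`, `e_1` and `e_3` contributions are now accounted for; what is
    -- left is minus the square of the `e_2` component.
    have hmass : mass.m (c s) ^ 2 = (E / w) ^ 2 - (E / w) ^ 2 * k := by linarith
    rw [h1', hnormal, hmass, neg_sq, mul_pow (E / w * _), mul_pow (E / w), hsk]
    have hs1 := Real.sin_sq_add_cos_sq Φ
    have hs2 := Real.sin_sq_add_cos_sq Θ
    linear_combination (E / w) ^ 2 * k * (Real.sin Θ ^ 2) * hs1 + (E / w) ^ 2 * k * hs2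
  have hS : v ⬝ᵥ ρ < 0 → Real.exp (K.Ψ (c Ω₀)) *
      (quad (M.gram (c Ω₀))⁻¹ ((-E / (v ⬝ᵥ ρ)) • ρ) + mass.m (c Ω₀) ^ 2)
      = E ^ 2 / (v ⬝ᵥ ρ) ^ 2 * quad (shadowMatrix K mass.m v w E (c Ω₀)) ρ := by
    intro hf
    have hne : v ⬝ᵥ ρ ≠ 0 := hf.ne
    rw [quad_shadowMatrix _ _ hwpos.ne', quad_smul]
    field_simp
  have hS' : v ⬝ᵥ ρ < 0 → (quad (gramPrime K (c Ω₀)) ((-E / (v ⬝ᵥ ρ)) • ρ)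
      + massPrime K mass.m (c Ω₀) = 0 ↔
        quad (shadowMatrixPrime K mass.m v w E (c Ω₀)) ρ = 0) := by
    intro hf
    have hne : v ⬝ᵥ ρ ≠ 0 := hf.ne
    rw [quad_shadowMatrixPrime mass v hwpos.ne' E hx₀, quad_smul]
    have : (-E / (v ⬝ᵥ ρ)) ^ 2 * quad (gramPrime K (c Ω₀)) ρ + massPrime K mass.m (c Ω₀)
        = E ^ 2 / (v ⬝ᵥ ρ) ^ 2 * (quad (gramPrime K (c Ω₀)) ρ
          + (v ⬝ᵥ ρ) ^ 2 / E ^ 2 * massPrime K mass.m (c Ω₀)) := by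
      field_simp
    rw [this, mul_eq_zero]
    exact or_iff_right (div_ne_zero (by positivity) (pow_ne_zero 2 hf.ne))
  have hcos_iff : v ⬝ᵥ ρ < 0 →
      (E ^ 2 / (v ⬝ᵥ ρ) ^ 2 * quad (shadowMatrix K mass.m v w E (c Ω₀)) ρ
        = Real.exp (K.Ψ (c s)) * -((E / w) ^ 2 * k * (Real.cos Φ * Real.sin Θ) ^ 2) ↔
      Real.exp (K.Ψ (c s)) * (k * (Real.cos Φ * Real.sin Θ) ^ 2)
        = -(w ^ 2 * quad (shadowMatrix K mass.m v w E (c Ω₀)) ρ) / (v ⬝ᵥ ρ) ^ 2) := by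
    intro hf
    have hne : v ⬝ᵥ ρ ≠ 0 := hf.ne
    generalize quad (shadowMatrix K mass.m v w E (c Ω₀)) ρ = Q
    generalize Real.exp (K.Ψ (c s)) = e
    generalize Real.cos Φ * Real.sin Θ = z
    generalize v ⬝ᵥ ρ = f at hne
    rw [eq_div_iff (pow_ne_zero 2 hne), div_mul_eq_mul_div, div_eq_iff (pow_ne_zero 2 hne), div_pow]
    constructor
    · intro h
      have : E ^ 2 * (e * (k * z ^ 2) * f ^ 2) = E ^ 2 * -(w ^ 2 * Q) := by
        linear_combination w ^ 2 * h
          + e * (k * z ^ 2) * f ^ 2 * (by field_simp : E ^ 2 = w ^ 2 * (E ^ 2 / w ^ 2))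
      exact mul_left_cancel₀ (by positivity) this
    · intro h
      have : w ^ 2 * (E ^ 2 * Q) = w ^ 2 * (e * -(E ^ 2 / w ^ 2 * k * z ^ 2) * f ^ 2) := by
        linear_combination E ^ 2 * h
          - e * (k * z ^ 2) * f ^ 2 * (by field_simp : E ^ 2 = w ^ 2 * (E ^ 2 / w ^ 2))
      exact mul_left_cancel₀ (by positivity) this
  constructor
  · rintro ⟨halt, hen, hf, himp, y, hy, hΩ, p, hp, -, hq, hsurf, hcart⟩
    have hay : a < M.Ω y := hΩ.symm ▸ hΩ₀
    rw [hc.carter_eq_iff mass hy hay hp hs hq, hΩ, hcos hen, himp, hS hf, hcos_iff hf] at hcart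
    rw [isMassiveParticleSurfaceAt_iff, hc.gramPrime_eq K hy hay, hc.massPrime_eq mass hy hay,
      hΩ, hq, himp, hS' hf] at hsurf
    exact ⟨halt, hen, hf, hsurf, (himpact hf).1 himp, hcart⟩
  · rintro ⟨halt, hen, hf, hsurf, hsin, hcart⟩
    have himp := (himpact hf).2 hsin
    have hcart' := (hcos_iff hf).2 hcart
    -- By the radial equation this quantity is minus a square up to a positive factor. That is the
    -- condition for a tangential particle with these charges to exist, and it can be placed at `c
    -- Ω₀` itself.
    have hneg : quad (M.gram (c Ω₀))⁻¹ (M.charge (c s) P) + mass.m (c Ω₀) ^ 2 ≤ 0 := by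
      rw [himp]
      have h1 : Real.exp (K.Ψ (c Ω₀)) *
          (quad (M.gram (c Ω₀))⁻¹ ((-E / (v ⬝ᵥ ρ)) • ρ) + mass.m (c Ω₀) ^ 2) ≤ 0 := by
        rw [hS hf, hcart', mul_neg, neg_nonpos]
        exact mul_nonneg (Real.exp_pos _).le
          (mul_nonneg (mul_nonneg (sq_nonneg _) (key hen)) (sq_nonneg _))
      exact nonpos_of_mul_nonpos_right h1 (Real.exp_pos _)
    obtain ⟨p, hp, hpp, hq⟩ := M.exists_tangential_momentum hx₀ h2' h2u hneg
    have hΩ := hc.param Ω₀ hΩ₀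
    refine ⟨halt, hen, hf, himp, c Ω₀, hx₀, hΩ, p, hp, hpp, hq, ?_, ?_⟩
    · rw [isMassiveParticleSurfaceAt_iff, hq, himp, hS' hf]
      exact hsurf
    · rw [hc.carter_eq_iff mass hx₀ (hΩ.symm ▸ hΩ₀) hp hs hq, hΩ, hcos hen, himp, hS hf, hcart']

end Shadow
namespace Shadow

/-! ### Continuity, stability of isotropic vectors, stereographic limits. -/

theorem continuous_quad :
    Continuous fun p : Matrix (Fin 2) (Fin 2) ℝ × (Fin 2 → ℝ) => quad p.1 p.2 := by
  unfold quad
  fun_prop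

theorem tendsto_quad {ι : Type*} {l : Filter ι} {B : ι → Matrix (Fin 2) (Fin 2) ℝ}
    {ρ : ι → Fin 2 → ℝ} {B₀ : Matrix (Fin 2) (Fin 2) ℝ} {ρ₀ : Fin 2 → ℝ}
    (hB : Tendsto B l (𝓝 B₀)) (hρ : Tendsto ρ l (𝓝 ρ₀)) :
    Tendsto (fun k => quad (B k) (ρ k)) l (𝓝 (quad B₀ ρ₀)) :=
  (continuous_quad.tendsto (B₀, ρ₀)).comp (hB.prodMk_nhds hρ)

theorem tendsto_dotProduct {ι : Type*} {l : Filter ι} {u w : ι → Fin 2 → ℝ} {u₀ w₀ : Fin 2 → ℝ}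
    (hu : Tendsto u l (𝓝 u₀)) (hw : Tendsto w l (𝓝 w₀)) :
    Tendsto (fun k => u k ⬝ᵥ w k) l (𝓝 (u₀ ⬝ᵥ w₀)) := by
  have hc : Continuous fun p : (Fin 2 → ℝ) × (Fin 2 → ℝ) => p.1 ⬝ᵥ p.2 := by fun_prop
  exact (hc.tendsto (u₀, w₀)).comp (hu.prodMk_nhds hw)

theorem tendsto_matrix {ι : Type*} {l : Filter ι} {B : ι → Matrix (Fin 2) (Fin 2) ℝ}
    {B₀ : Matrix (Fin 2) (Fin 2) ℝ} (h : ∀ i j, Tendsto (fun k => B k i j) l (𝓝 (B₀ i j))) :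
    Tendsto B l (𝓝 B₀) :=
  tendsto_pi_nhds.2 fun i => tendsto_pi_nhds.2 fun j => h i j

/-- A nonzero isotropic vector of a nondegenerate indefinite quadratic form is a limit of isotropic
vectors of approximating forms. -/
theorem exists_tendsto_isotropic {ι : Type*} {l : Filter ι} {B : ι → Matrix (Fin 2) (Fin 2) ℝ}
    {B₀ : Matrix (Fin 2) (Fin 2) ℝ} (hB : Tendsto B l (𝓝 B₀)) (hdet : B₀.det < 0)
    {ρ₀ : Fin 2 → ℝ} (hρ : ρ₀ ≠ 0) (h0 : quad B₀ ρ₀ = 0) :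
    ∃ ρ : ι → Fin 2 → ℝ, (∀ᶠ k in l, quad (B k) (ρ k) = 0) ∧ Tendsto ρ l (𝓝 ρ₀) := by
  -- The gradient of the form at `ρ₀`. Moving in this direction changes the value of `B₀` to first
  -- order, with slope `w · w`.
  set w : Fin 2 → ℝ := (B₀ + B₀ᵀ) *ᵥ ρ₀ with hw
  have hw0 : w ≠ 0 := by
    intro h
    -- Symmetrisation keeps the determinant negative: it equals `4 det B₀ - (b₀₁ - b₁₀)²`.
    refine hρ (Matrix.eq_zero_of_mulVec_eq_zero ?_ h)
    rw [Matrix.det_fin_two] at hdet ⊢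
    simp only [Matrix.add_apply, Matrix.transpose_apply]
    nlinarith [sq_nonneg (B₀ 0 1 - B₀ 1 0)]
  have hww : 0 < w ⬝ᵥ w := by
    have h : 0 ≤ w ⬝ᵥ w := Finset.sum_nonneg fun i _ => mul_self_nonneg (w i)
    exact h.lt_of_ne fun h => hw0 (dotProduct_self_eq_zero.1 h.symm)
  set β : Matrix (Fin 2) (Fin 2) ℝ → ℝ := fun A => w ⬝ᵥ ((A + Aᵀ) *ᵥ ρ₀) with hβ
  have hβ0 : β B₀ = w ⬝ᵥ w := rfl
  have hexp : ∀ (A : Matrix (Fin 2) (Fin 2) ℝ) (t : ℝ),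
      quad A (ρ₀ + t • w) = quad A ρ₀ + t * β A + t ^ 2 * quad A w := by
    intro A t
    simp only [hβ, quad_fin_two]
    simp only [dotProduct, Matrix.mulVec, Fin.sum_univ_two, Matrix.add_apply,
      Matrix.transpose_apply, Pi.add_apply, Pi.smul_apply, smul_eq_mul]
    ring
  have hβt : Tendsto (fun k => β (B k)) l (𝓝 (β B₀)) := by
    have : Continuous β := by fun_prop
    exact (this.tendsto _).comp hB
  have hct : Tendsto (fun k => quad (B k) ρ₀) l (𝓝 0) := h0 ▸ tendsto_quad hB tendsto_const_nhds
  have hat : Tendsto (fun k => quad (B k) w) l (𝓝 (quad B₀ w)) :=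
    tendsto_quad hB tendsto_const_nhds
  have hDt : Tendsto (fun k => β (B k) ^ 2 - 4 * (quad (B k) w * quad (B k) ρ₀)) l
      (𝓝 (β B₀ ^ 2)) := by
    have := (hβt.pow 2).sub ((hat.mul hct).const_mul 4)
    simpa using this
  have hut : Tendsto (fun k => β (B k)
      + Real.sqrt (β (B k) ^ 2 - 4 * (quad (B k) w * quad (B k) ρ₀))) l (𝓝 (β B₀ + β B₀)) := by
    have := hβt.add ((Real.continuous_sqrt.tendsto _).comp hDt)
    rwa [Real.sqrt_sq (hβ0 ▸ hww.le)] at this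
  have hβpos : 0 < β B₀ := hβ0 ▸ hww
  -- The small root of the quadratic equation for `t`, rationalised so that it stays valid when the
  -- leading coefficient vanishes, and visibly tends to `0` with the constant term.
  refine ⟨fun k => ρ₀ + (-2 * quad (B k) ρ₀ / (β (B k)
      + Real.sqrt (β (B k) ^ 2 - 4 * (quad (B k) w * quad (B k) ρ₀)))) • w, ?_, ?_⟩
  · filter_upwards [hDt.eventually (lt_mem_nhds (pow_pos hβpos 2)),
      hut.eventually (lt_mem_nhds (add_pos hβpos hβpos))] with k hD hu
    rw [hexp]
    have hsq := Real.sq_sqrt hD.le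
    set d := Real.sqrt (β (B k) ^ 2 - 4 * (quad (B k) w * quad (B k) ρ₀))
    field_simp
    linear_combination quad (B k) ρ₀ * hsq
  · have ht := (hct.const_mul (-2)).div hut (add_pos hβpos hβpos).ne'
    have := (tendsto_const_nhds (x := ρ₀)).add (ht.smul_const w)
    simpa using this

theorem tan_half_eq {Θ : ℝ} (h : Θ ∈ Set.Icc 0 (Real.pi / 2)) :
    Real.tan (Θ / 2) = Real.sin Θ / (1 + Real.cos Θ) := by
  have hc : 0 < Real.cos (Θ / 2) :=
    Real.cos_pos_of_mem_Ioo ⟨by linarith [h.1, Real.pi_pos], by linarith [h.2, Real.pi_pos]⟩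
  have h1 : Real.sin Θ = 2 * Real.sin (Θ / 2) * Real.cos (Θ / 2) := by
    rw [← Real.sin_two_mul]
    ring_nf
  have h2 : 1 + Real.cos Θ = 2 * Real.cos (Θ / 2) ^ 2 := by
    rw [Real.cos_sq]
    ring_nf
  rw [h1, h2, Real.tan_eq_sin_div_cos]
  field_simp

/-- Limits of rescaled stereographic coordinates of directions that approach the zenith. -/
theorem tendsto_stereo {l : Filter ℝ} {b Φ Θ : ℝ → ℝ} {A B : ℝ} (hb : Tendsto b l atTop)
    (hΘ : ∀ᶠ s in l, Θ s ∈ Set.Icc 0 (Real.pi / 2))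
    (hA : Tendsto (fun s => Real.sin (Φ s) * Real.sin (Θ s) * b s) l (𝓝 A))
    (hB : Tendsto (fun s => |Real.cos (Φ s) * Real.sin (Θ s)| * b s) l (𝓝 B)) :
    Tendsto (fun s => stereoX (Φ s) (Θ s) * b s) l (𝓝 (-A)) ∧
    Tendsto (fun s => |stereoY (Φ s) (Θ s)| * b s) l (𝓝 B) ∧
    ∀ sgn : ℝ, sgn = 1 ∨ sgn = -1 → (∀ᶠ s in l, 0 ≤ sgn * Real.cos (Φ s)) →
      Tendsto (fun s => stereoY (Φ s) (Θ s) * b s) l (𝓝 (-(sgn * B))) := by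
  -- The squares of the two projections add up to `sin² Θ`, and both are bounded after
  -- multiplication by `b → ∞`.
  have hsin2 : Tendsto (fun s => Real.sin (Θ s) ^ 2) l (𝓝 0) := by
    have h := ((hA.pow 2).add (hB.pow 2)).mul ((tendsto_inv_atTop_zero.comp hb).pow 2)
    rw [zero_pow two_ne_zero, mul_zero] at h
    refine h.congr' ?_
    filter_upwards [hb.eventually_gt_atTop 0] with s hs
    simp only [Function.comp_apply]
    rw [mul_pow |_|, sq_abs]
    have := Real.sin_sq_add_cos_sq (Φ s)
    field_simp
    linear_combination Real.sin (Θ s) ^ 2 * this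
  have hcos : Tendsto (fun s => 2 / (1 + Real.cos (Θ s))) l (𝓝 1) := by
    -- The bound `Θ ≤ π / 2` selects the nonnegative cosine, hence the zenith and not the nadir.
    have h1 : Tendsto (fun s => Real.cos (Θ s)) l (𝓝 1) := by
      have h := (Real.continuous_sqrt.tendsto _).comp (hsin2.const_sub 1)
      rw [sub_zero, Real.sqrt_one] at h
      refine h.congr' ?_
      filter_upwards [hΘ] with s hs
      have hc : 0 ≤ Real.cos (Θ s) :=
        Real.cos_nonneg_of_mem_Icc ⟨by linarith [hs.1, Real.pi_pos], hs.2⟩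
      rw [Function.comp_apply, ← Real.cos_sq', Real.sqrt_sq hc]
    have h := (tendsto_const_nhds (x := (2 : ℝ))).div (h1.const_add 1) (by norm_num)
    norm_num at h
    exact h
  have hsin : ∀ᶠ s in l, 0 ≤ Real.sin (Θ s) := by
    filter_upwards [hΘ] with s hs
    exact Real.sin_nonneg_of_nonneg_of_le_pi hs.1 (by linarith [hs.2, Real.pi_pos])
  have hcpos : ∀ᶠ s in l, 0 < 1 + Real.cos (Θ s) := by
    filter_upwards [hΘ] with s hs
    have hc : 0 ≤ Real.cos (Θ s) :=
      Real.cos_nonneg_of_mem_Icc ⟨by linarith [hs.1, Real.pi_pos], hs.2⟩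
    linarith
  refine ⟨?_, ?_, fun sgn hsgn hbr => ?_⟩
  · have h := (hcos.mul hA).neg
    rw [one_mul] at h
    refine h.congr' ?_
    filter_upwards [hΘ] with s hs
    rw [stereoX, tan_half_eq hs]
    ring
  · have h := hcos.mul hB
    rw [one_mul] at h
    refine h.congr' ?_
    filter_upwards [hΘ, hcpos] with s hs hc
    have : stereoY (Φ s) (Θ s)
        = -(2 / (1 + Real.cos (Θ s)) * (Real.cos (Φ s) * Real.sin (Θ s))) := by
      rw [stereoY, tan_half_eq hs]
      ring
    rw [this, abs_neg, abs_mul (2 / _), abs_of_pos (div_pos two_pos hc)]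
    ring
  · have h := ((hcos.mul hB).const_mul sgn).neg
    rw [one_mul] at h
    refine h.congr' ?_
    filter_upwards [hΘ, hsin, hbr] with s hs hsn hbr
    have habs : |Real.cos (Φ s) * Real.sin (Θ s)| = sgn * (Real.cos (Φ s) * Real.sin (Θ s)) := by
      rcases hsgn with rfl | rfl
      · rw [one_mul] at hbr ⊢
        exact abs_of_nonneg (mul_nonneg hbr hsn)
      · rw [neg_one_mul]
        exact abs_of_nonpos (mul_nonpos_of_nonpos_of_nonneg (by linarith) hsn)
    have hss : sgn * sgn = 1 := by rcases hsgn with rfl | rfl <;> norm_num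
    rw [stereoY, tan_half_eq hs, habs]
    linear_combination (-(2 / (1 + Real.cos (Θ s)) * (Real.cos (Φ s) * Real.sin (Θ s)) * b s)) * hss

/-- A direction in the hemisphere of the zenith with given orthogonal projection. -/
theorem exists_direction {x y : ℝ} (h : x ^ 2 + y ^ 2 ≤ 1) :
    ∃ p : ℝ × ℝ, p.2 ∈ Set.Icc 0 (Real.pi / 2) ∧ Real.sin p.1 * Real.sin p.2 = x ∧
      Real.cos p.1 * Real.sin p.2 = y := by
  -- Polar coordinates: the azimuth is the argument of `y + i x` and `sin Θ` is its modulus.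
  set z : ℂ := ⟨y, x⟩
  have hz : ‖z‖ ≤ 1 := by
    rw [← sq_le_one_iff₀ (norm_nonneg z), ← Complex.normSq_eq_norm_sq, Complex.normSq_mk]
    linarith
  refine ⟨(z.arg, Real.arcsin ‖z‖), ⟨Real.arcsin_nonneg.2 (norm_nonneg z),
    Real.arcsin_le_pi_div_two _⟩, ?_, ?_⟩
  · rw [Real.sin_arcsin (by linarith [norm_nonneg z]) hz, mul_comm, Complex.norm_mul_sin_arg]
  · rw [Real.sin_arcsin (by linarith [norm_nonneg z]) hz, mul_comm, Complex.norm_mul_cos_arg]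

/-! ### The limiting shadow matrices and their dependence on the mass. -/

section LimitingMatrices

variable {M : FoliatedSpacetime} {K : SliceReducible M} {x : Coord} {vInf vLowInf : Fin 2 → ℝ}

theorem SInf_apply (h : vInf 1 = 0 ∧ vLowInf 0 = -vInf 0) (m : Coord → ℝ) (E : ℝ) (x : Coord)
    (i j : Fin 2) :
    SInf K m vInf vLowInf E x i j = Real.exp (K.Ψ x) * (M.gram x)⁻¹ i j
      + vInf i * vInf j / E ^ 2 * (Real.exp (K.Ψ x) * m x ^ 2) := by
  -- If the limiting norm is zero, so is the limiting velocity; both mass terms then vanish and the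
  -- formula survives the division by zero.
  by_cases h0 : speedInf vInf vLowInf = 0
  · have hv : vInf = 0 := by
      rw [speedInf_eq h, abs_eq_zero] at h0
      funext k
      fin_cases k
      · exact h0
      · exact h.1
    simp [SInf, shadowMatrix, hv]
  · exact shadowMatrix_apply m vInf h0 E x i j

theorem massTerm_eq (m : Coord → ℝ) (E : ℝ) (x : Coord) :
    massTerm K m vInf vLowInf E x
      = speedInf vInf vLowInf ^ 2 / E ^ 2 * (Real.exp (K.Ψ x) * m x ^ 2) := by
  unfold massTerm energyMassSq
  ring

theorem prime_massTerm (mass : SeparableMass K) (E : ℝ) (hx : x ∈ M.U) :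
    M.prime (massTerm K mass.m vInf vLowInf E) x
      = speedInf vInf vLowInf ^ 2 / E ^ 2 * massPrime K mass.m x := by
  have : massTerm K mass.m vInf vLowInf E = fun y =>
      speedInf vInf vLowInf ^ 2 / E ^ 2 * (Real.exp (K.Ψ y) * mass.m y ^ 2) :=
    funext fun y => massTerm_eq mass.m E y
  rw [this, massPrime, M.prime_eq_fderiv, M.prime_eq_fderiv,
    fderiv_const_mul (mass.differentiableAt_exp_sq hx)]
  rfl

theorem massPrime_massless (x : Coord) : massPrime K (massless K).m x = 0 := by
  simp [massPrime, massless, FoliatedSpacetime.prime_eq_fderiv]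

/-- The deviation from the massless matrix is linear in `massTerm`; with its analogue for the prime
this carries all of the scaling statements. -/
theorem SInf_apply_eq_massless {E : ℝ} (hE : E ≠ 0) (h : vInf 1 = 0 ∧ vLowInf 0 = -vInf 0)
    (hs : speedInf vInf vLowInf ≠ 0) (m : Coord → ℝ) (x : Coord) (i j : Fin 2) :
    SInf K m vInf vLowInf E x i j = SInf K (massless K).m vInf vLowInf E x i j
      + vInf i * vInf j / speedInf vInf vLowInf ^ 2 * massTerm K m vInf vLowInf E x := by
  rw [SInf_apply h, SInf_apply h, massTerm_eq]
  simp only [massless]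
  field_simp
  ring

theorem SInfPrime_apply (mass : SeparableMass K) (hs : speedInf vInf vLowInf ≠ 0) (E : ℝ)
    (hx : x ∈ M.U) (i j : Fin 2) :
    SInfPrime K mass.m vInf vLowInf E x i j = gramPrime K x i j
      + vInf i * vInf j / E ^ 2 * massPrime K mass.m x :=
  shadowMatrixPrime_apply mass vInf hs E hx i j

theorem SInfPrime_apply_eq_massless (mass : SeparableMass K) {E : ℝ} (hE : E ≠ 0)
    (hs : speedInf vInf vLowInf ≠ 0) (hx : x ∈ M.U) (i j : Fin 2) :
    SInfPrime K mass.m vInf vLowInf E x i j = SInfPrime K (massless K).m vInf vLowInf E x i j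
      + vInf i * vInf j / speedInf vInf vLowInf ^ 2
        * M.prime (massTerm K mass.m vInf vLowInf E) x := by
  rw [SInfPrime_apply mass hs E hx, SInfPrime_apply (massless K) hs E hx, massPrime_massless,
    prime_massTerm mass E hx]
  field_simp
  ring

variable {ι : Type*} {l : Filter ι} {v : ι → Fin 2 → ℝ} {w : ι → ℝ}

theorem tendsto_shadowMatrix (h : vInf 1 = 0 ∧ vLowInf 0 = -vInf 0) (m : Coord → ℝ) (E : ℝ)
    (x : Coord) (hv : Tendsto v l (𝓝 vInf)) (hw : ∀ᶠ k in l, w k ≠ 0) :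
    Tendsto (fun k => shadowMatrix K m (v k) (w k) E x) l (𝓝 (SInf K m vInf vLowInf E x)) := by
  refine tendsto_matrix fun i j => ?_
  rw [SInf_apply h]
  have hv' := tendsto_pi_nhds.1 hv
  refine (((((hv' i).mul (hv' j)).div_const _).mul_const _).const_add _).congr' ?_
  filter_upwards [hw] with k hk
  rw [shadowMatrix_apply m (v k) hk]

theorem tendsto_shadowMatrixPrime (mass : SeparableMass K) (hs : speedInf vInf vLowInf ≠ 0) (E : ℝ)
    (hx : x ∈ M.U) (hv : Tendsto v l (𝓝 vInf)) (hw : ∀ᶠ k in l, w k ≠ 0) :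
    Tendsto (fun k => shadowMatrixPrime K mass.m (v k) (w k) E x) l
      (𝓝 (SInfPrime K mass.m vInf vLowInf E x)) := by
  refine tendsto_matrix fun i j => ?_
  rw [SInfPrime_apply mass hs E hx]
  have hv' := tendsto_pi_nhds.1 hv
  refine (((((hv' i).mul (hv' j)).div_const _).mul_const _).const_add _).congr' ?_
  filter_upwards [hw] with k hk
  rw [shadowMatrixPrime_apply mass (v k) hk E hx]

end LimitingMatrices

theorem ne_zero_of_dotProduct_neg {u ρ : Fin 2 → ℝ} (h : u ⬝ᵥ ρ < 0) : ρ ≠ 0 := by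
  rintro rfl
  simp at h

end Shadow
namespace Shadow

/-! ### Limits of shadow points, and the converse construction. -/

variable {M : FoliatedSpacetime} {K : SliceReducible M} {a : ℝ} {c : ℝ → Coord}
  {vInf vLowInf ρInf : Fin 2 → ℝ} {α E mInf : ℝ}

theorem Observer.speed_pos (O : Observer M a c) {s : ℝ} (hs : a < s) :
    0 < M.speed (c s) (O.v s) :=
  Real.sqrt_pos.2 (by linarith [O.timelike s hs])

theorem tendsto_energyMassSq {mass : SeparableMass K} {O : Observer M a c}
    (hw : Tendsto (fun s => M.speed (c s) (O.v s)) atTop (𝓝 (speedInf vInf vLowInf)))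
    (hm : Tendsto (fun s => mass.m (c s)) atTop (𝓝 mInf)) :
    Tendsto (fun s => 1 - energyMassSq (M.speed (c s) (O.v s)) (mass.m (c s)) E) atTop
      (𝓝 (1 - energyMassSq (speedInf vInf vLowInf) mInf E)) :=
  ((((hw.pow 2).mul (hm.pow 2)).div_const _).const_sub 1)

/-- The rescaled horizontal projection of the direction of a point of the shadow boundary. -/
theorem tendsto_horizontal {mass : SeparableMass K} {O : Observer M a c} {ρ : ℝ → Fin 2 → ℝ}
    (hc : IsNormalLine M a c) (hv : Tendsto O.v atTop (𝓝 vInf))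
    (hw : Tendsto (fun s => M.speed (c s) (O.v s)) atTop (𝓝 (speedInf vInf vLowInf)))
    (hτ : Tendsto (fun s => M.sqrtDet (c s) • M.tau (c s) (O.v s)) atTop (𝓝 (epsUp *ᵥ vLowInf)))
    (hα : Tendsto (fun s => Real.exp (K.Ψ (c s) / 2) / M.sqrtDet (c s)) atTop (𝓝 α))
    (hm : Tendsto (fun s => mass.m (c s)) atTop (𝓝 mInf))
    (hlt : energyMassSq (speedInf vInf vLowInf) mInf E < 1)
    (hρ : Tendsto ρ atTop (𝓝 ρInf)) (hneg : vInf ⬝ᵥ ρInf < 0) :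
    Tendsto (fun s => -(M.tau (c s) (O.v s) ⬝ᵥ ρ s) / (O.v s ⬝ᵥ ρ s)
        / Real.sqrt (1 - energyMassSq (M.speed (c s) (O.v s)) (mass.m (c s)) E)
        * Real.exp (K.Ψ (c s) / 2)) atTop
      (𝓝 (-XInf α vInf vLowInf (energyMassSq (speedInf vInf vLowInf) mInf E) ρInf)) := by
  have hk := tendsto_energyMassSq (E := E) hw hm
  have hsk := (Real.continuous_sqrt.tendsto _).comp hk
  have hsk0 : Real.sqrt (1 - energyMassSq (speedInf vInf vLowInf) mInf E) ≠ 0 :=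
    (Real.sqrt_pos.2 (by linarith)).ne'
  -- The factor `e^{Ψ/2} τ` is split as `(e^{Ψ/2} / √(-det G)) · (√(-det G) τ)`, a product of two
  -- convergent terms.
  have h := ((hα.mul (tendsto_dotProduct hτ hρ)).div (hsk.mul (tendsto_dotProduct hv hρ))
    (mul_ne_zero hsk0 hneg.ne)).neg
  refine h.congr' ?_
  filter_upwards [eventually_gt_atTop a] with s hs
  have hD := M.sqrtDet_pos (hc.mem s hs)
  simp only [Pi.div_apply, Function.comp_apply, smul_dotProduct, smul_eq_mul]
  rw [div_mul_eq_mul_div, mul_comm (M.sqrtDet _), ← mul_assoc, mul_div_cancel_right₀ _ hD.ne']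
  simp only [div_eq_mul_inv, mul_inv]
  ring

/-- The rescaled square of the vertical projection of the direction of a point of the shadow
boundary. -/
theorem tendsto_vertical {mass : SeparableMass K} {O : Observer M a c} {ρ : ℝ → Fin 2 → ℝ}
    {S : ℝ → Matrix (Fin 2) (Fin 2) ℝ} {SInf : Matrix (Fin 2) (Fin 2) ℝ}
    (hv : Tendsto O.v atTop (𝓝 vInf))
    (hw : Tendsto (fun s => M.speed (c s) (O.v s)) atTop (𝓝 (speedInf vInf vLowInf)))
    (hm : Tendsto (fun s => mass.m (c s)) atTop (𝓝 mInf))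
    (hlt : energyMassSq (speedInf vInf vLowInf) mInf E < 1)
    (hS : Tendsto S atTop (𝓝 SInf))
    (hρ : Tendsto ρ atTop (𝓝 ρInf)) (hneg : vInf ⬝ᵥ ρInf < 0) :
    Tendsto (fun s => Real.sqrt (-(M.speed (c s) (O.v s) ^ 2 * quad (S s) (ρ s))
        / (O.v s ⬝ᵥ ρ s) ^ 2 / (1 - energyMassSq (M.speed (c s) (O.v s)) (mass.m (c s)) E)))
      atTop (𝓝 (-YInf 1 SInf vInf vLowInf
        (energyMassSq (speedInf vInf vLowInf) mInf E) ρInf)) := by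
  have hk := tendsto_energyMassSq (E := E) hw hm
  have hk0 : 0 < 1 - energyMassSq (speedInf vInf vLowInf) mInf E := by linarith
  have h := (Real.continuous_sqrt.tendsto _).comp
    ((((hw.pow 2).mul (tendsto_quad hS hρ)).neg.div ((tendsto_dotProduct hv hρ).pow 2)
      (pow_ne_zero 2 hneg.ne)).div hk hk0.ne')
  refine (h.congr fun _ => rfl).trans (le_of_eq (congrArg _ ?_))
  have hw0 : 0 ≤ speedInf vInf vLowInf := Real.sqrt_nonneg _
  -- The square root produces `|v · ρ| = -(v · ρ)`, which is the origin of the minus sign.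
  rw [YInf, one_mul, Real.sqrt_div' _ hk0.le, Real.sqrt_div' _ (sq_nonneg _), ← mul_neg,
    Real.sqrt_mul (sq_nonneg _), Real.sqrt_sq hw0, Real.sqrt_sq_eq_abs, abs_of_neg hneg]
  have hne := hneg.ne
  have hsk0 : Real.sqrt (1 - energyMassSq (speedInf vInf vLowInf) mInf E) ≠ 0 :=
    (Real.sqrt_pos.2 hk0).ne'
  simp only [div_eq_mul_inv, mul_inv, inv_neg]
  ring

theorem sign_neg_YInf (S : Matrix (Fin 2) (Fin 2) ℝ) (sgn mE2 : ℝ) :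
    -(sgn * -YInf 1 S vInf vLowInf mE2 ρInf) = YInf sgn S vInf vLowInf mE2 ρInf := by
  unfold YInf
  ring

theorem YInf_one_nonpos (S : Matrix (Fin 2) (Fin 2) ℝ) (mE2 : ℝ) (hneg : vInf ⬝ᵥ ρInf < 0) :
    YInf 1 S vInf vLowInf mE2 ρInf ≤ 0 := by
  unfold YInf
  rw [one_mul]
  exact div_nonpos_of_nonneg_of_nonpos (mul_nonneg (Real.sqrt_nonneg _) (Real.sqrt_nonneg _))
    (mul_nonpos_of_nonneg_of_nonpos (Real.sqrt_nonneg _) hneg.le)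

/-- Every convergent family of points of the shadow boundary has the stated limit. -/
theorem shadowBoundary_limit {Ω₀ : ℝ} {mass : SeparableMass K} {O : Observer M a c}
    (hc : IsNormalLine M a c) (hΨ : Tendsto (fun s => K.Ψ (c s)) atTop atTop)
    (hvel : vInf 1 = 0 ∧ vLowInf 0 = -vInf 0) (hv : Tendsto O.v atTop (𝓝 vInf))
    (hw : Tendsto (fun s => M.speed (c s) (O.v s)) atTop (𝓝 (speedInf vInf vLowInf)))
    (hτ : Tendsto (fun s => M.sqrtDet (c s) • M.tau (c s) (O.v s)) atTop (𝓝 (epsUp *ᵥ vLowInf)))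
    (hα : Tendsto (fun s => Real.exp (K.Ψ (c s) / 2) / M.sqrtDet (c s)) atTop (𝓝 α))
    (hE : 0 < E) (hΩ₀ : a < Ω₀)
    (hm : Tendsto (fun s => mass.m (c s)) atTop (𝓝 mInf))
    (hlt : energyMassSq (speedInf vInf vLowInf) mInf E < 1)
    {ρ : ℝ → Fin 2 → ℝ} {Φ Θ : ℝ → ℝ}
    (hsh : ∀ᶠ s in atTop,
      IsShadowBoundary K mass (c s) (O.v s) (O.e2 s) E Ω₀ (ρ s) (Φ s) (Θ s))
    (hρ : Tendsto ρ atTop (𝓝 ρInf)) (hneg : vInf ⬝ᵥ ρInf < 0) :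
    quad (SInfPrime K mass.m vInf vLowInf E (c Ω₀)) ρInf = 0 ∧
    quad (SInf K mass.m vInf vLowInf E (c Ω₀)) ρInf ≤ 0 ∧
    Tendsto (fun s => stereoX (Φ s) (Θ s) * Real.exp (K.Ψ (c s) / 2)) atTop
      (𝓝 (XInf α vInf vLowInf (energyMassSq (speedInf vInf vLowInf) mInf E) ρInf)) ∧
    Tendsto (fun s => |stereoY (Φ s) (Θ s)| * Real.exp (K.Ψ (c s) / 2)) atTop
      (𝓝 |YInf 1 (SInf K mass.m vInf vLowInf E (c Ω₀))
        vInf vLowInf (energyMassSq (speedInf vInf vLowInf) mInf E) ρInf|) ∧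
    ∀ sgn : ℝ, sgn = 1 ∨ sgn = -1 → (∀ᶠ s in atTop, 0 ≤ sgn * Real.cos (Φ s)) →
      Tendsto (fun s => stereoY (Φ s) (Θ s) * Real.exp (K.Ψ (c s) / 2)) atTop
        (𝓝 (YInf sgn (SInf K mass.m vInf vLowInf E (c Ω₀))
          vInf vLowInf (energyMassSq (speedInf vInf vLowInf) mInf E) ρInf)) := by
  have hs0 := (speedInf_pos hvel hneg).ne'
  have hx₀ := hc.mem Ω₀ hΩ₀
  have hwne : ∀ᶠ s in atTop, M.speed (c s) (O.v s) ≠ 0 :=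
    (eventually_gt_atTop a).mono fun s hs => (O.speed_pos hs).ne'
  have heq : ∀ᶠ s in atTop, Θ s ∈ Set.Icc 0 (Real.pi / 2) ∧ O.v s ⬝ᵥ ρ s < 0 ∧
      ShadowEquations K mass (c Ω₀) (c s) (O.v s) E (ρ s) (Φ s) (Θ s) := by
    filter_upwards [hsh, eventually_gt_atTop a] with s h hs
    obtain ⟨h1, -, h2, h3⟩ := (isShadowBoundary_iff hc mass hs hΩ₀ (O.timelike s hs)
      (O.e2_transverse s hs) (O.e2_transverse Ω₀ hΩ₀) (O.e2_unit Ω₀ hΩ₀) hE).1 h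
    exact ⟨h1, h2, h3⟩
  have hk : ∀ᶠ s in atTop,
      0 < 1 - energyMassSq (M.speed (c s) (O.v s)) (mass.m (c s)) E :=
    (tendsto_energyMassSq hw hm).eventually (lt_mem_nhds (by linarith))
  have hSt := tendsto_shadowMatrix (K := K) hvel mass.m E (c Ω₀) hv hwne
  have hS't := tendsto_shadowMatrixPrime mass hs0 E hx₀ hv hwne
  have hb : Tendsto (fun s => Real.exp (K.Ψ (c s) / 2)) atTop atTop :=
    Real.tendsto_exp_atTop.comp (hΨ.atTop_div_const two_pos)
  have hA : Tendsto (fun s => Real.sin (Φ s) * Real.sin (Θ s) * Real.exp (K.Ψ (c s) / 2)) atTop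
      (𝓝 (-XInf α vInf vLowInf (energyMassSq (speedInf vInf vLowInf) mInf E) ρInf)) := by
    refine (tendsto_horizontal hc hv hw hτ hα hm hlt hρ hneg).congr' ?_
    filter_upwards [heq, hk] with s ⟨_, _, h⟩ hk
    rw [← h.sin_eq, mul_div_cancel_left₀ _ (Real.sqrt_pos.2 hk).ne']
  have hB : Tendsto (fun s => |Real.cos (Φ s) * Real.sin (Θ s)| * Real.exp (K.Ψ (c s) / 2)) atTop
      (𝓝 (-YInf 1 (SInf K mass.m vInf vLowInf E (c Ω₀)) vInf vLowInf
        (energyMassSq (speedInf vInf vLowInf) mInf E) ρInf)) := by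
    refine (tendsto_vertical hv hw hm hlt hSt hρ hneg).congr' ?_
    filter_upwards [heq, hk] with s ⟨_, _, h⟩ hk
    rw [← h.cos_eq, mul_left_comm, mul_div_cancel_left₀ _ hk.ne',
      Real.sqrt_mul (Real.exp_pos _).le, Real.sqrt_sq_eq_abs, Real.exp_half, mul_comm]
  obtain ⟨r1, r2, r3⟩ := tendsto_stereo hb (heq.mono fun _ h => h.1) hA hB
  rw [neg_neg] at r1
  refine ⟨?_, ?_, r1, ?_, fun sgn hsgn hbr => sign_neg_YInf
    (SInf K mass.m vInf vLowInf E (c Ω₀)) sgn _ ▸ r3 sgn hsgn hbr⟩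
  · exact tendsto_nhds_unique (tendsto_quad hS't hρ)
      (tendsto_const_nhds.congr' (heq.mono fun s h => h.2.2.surface.symm))
  · refine le_of_tendsto (tendsto_quad hSt hρ) ?_
    filter_upwards [heq, hk, eventually_gt_atTop a] with s ⟨_, hf, h⟩ hk hs
    -- The radial equation equates this expression with `e^Ψ` times a nonnegative number, so the
    -- sign of the shadow form holds before the limit.
    have h1 : 0 ≤ -(M.speed (c s) (O.v s) ^ 2 *
        quad (shadowMatrix K mass.m (O.v s) (M.speed (c s) (O.v s)) E (c Ω₀)) (ρ s))
          / (O.v s ⬝ᵥ ρ s) ^ 2 := by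
      rw [← h.cos_eq]
      exact mul_nonneg (Real.exp_pos _).le (mul_nonneg hk.le (sq_nonneg _))
    rw [le_div_iff₀ (sq_pos_of_ne_zero hf.ne), zero_mul, neg_nonneg] at h1
    exact nonpos_of_mul_nonpos_right h1 (pow_pos (O.speed_pos hs) 2)
  · rw [abs_of_nonpos (YInf_one_nonpos _ _ hneg)]
    exact r2

/-- Every convergent family of solutions of the equation for the impact parameter vector comes from
points of the shadow boundary. -/
theorem exists_shadowBoundary {Ω₀ : ℝ} {mass : SeparableMass K} {O : Observer M a c}
    (hc : IsNormalLine M a c) (hΨ : Tendsto (fun s => K.Ψ (c s)) atTop atTop)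
    (hvel : vInf 1 = 0 ∧ vLowInf 0 = -vInf 0) (hv : Tendsto O.v atTop (𝓝 vInf))
    (hw : Tendsto (fun s => M.speed (c s) (O.v s)) atTop (𝓝 (speedInf vInf vLowInf)))
    (hτ : Tendsto (fun s => M.sqrtDet (c s) • M.tau (c s) (O.v s)) atTop (𝓝 (epsUp *ᵥ vLowInf)))
    (hα : Tendsto (fun s => Real.exp (K.Ψ (c s) / 2) / M.sqrtDet (c s)) atTop (𝓝 α))
    (hE : 0 < E) (hΩ₀ : a < Ω₀)
    (hm : Tendsto (fun s => mass.m (c s)) atTop (𝓝 mInf))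
    (hlt : energyMassSq (speedInf vInf vLowInf) mInf E < 1)
    {ρ : ℝ → Fin 2 → ℝ} {sgn : ℝ} (hsgn : sgn = 1 ∨ sgn = -1)
    (hsurf : ∀ᶠ s in atTop,
      quad (shadowMatrixPrime K mass.m (O.v s) (M.speed (c s) (O.v s)) E (c Ω₀)) (ρ s) = 0)
    (hρ : Tendsto ρ atTop (𝓝 ρInf)) (hneg : vInf ⬝ᵥ ρInf < 0)
    (hS : quad (SInf K mass.m vInf vLowInf E (c Ω₀)) ρInf < 0) :
    ∃ Φ Θ : ℝ → ℝ, ∀ᶠ s in atTop,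
      IsShadowBoundary K mass (c s) (O.v s) (O.e2 s) E Ω₀ (ρ s) (Φ s) (Θ s) ∧
      0 ≤ sgn * Real.cos (Φ s) := by
  have hwne : ∀ᶠ s in atTop, M.speed (c s) (O.v s) ≠ 0 :=
    (eventually_gt_atTop a).mono fun s hs => (O.speed_pos hs).ne'
  have hk : ∀ᶠ s in atTop,
      0 < 1 - energyMassSq (M.speed (c s) (O.v s)) (mass.m (c s)) E :=
    (tendsto_energyMassSq hw hm).eventually (lt_mem_nhds (by linarith))
  have hSt := tendsto_shadowMatrix (K := K) hvel mass.m E (c Ω₀) hv hwne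
  have hb : Tendsto (fun s => Real.exp (K.Ψ (c s) / 2)) atTop atTop :=
    Real.tendsto_exp_atTop.comp (hΨ.atTop_div_const two_pos)
  have hf : ∀ᶠ s in atTop, O.v s ⬝ᵥ ρ s < 0 :=
    (tendsto_dotProduct hv hρ).eventually (gt_mem_nhds hneg)
  have hQ : ∀ᶠ s in atTop,
      quad (shadowMatrix K mass.m (O.v s) (M.speed (c s) (O.v s)) E (c Ω₀)) (ρ s) < 0 :=
    (tendsto_quad hSt hρ).eventually (gt_mem_nhds hS)
  -- `X` and `sgn √Z / e^{Ψ/2}` are the two projections that the shadow equations prescribe.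
  set X : ℝ → ℝ := fun s => -(M.tau (c s) (O.v s) ⬝ᵥ ρ s) / (O.v s ⬝ᵥ ρ s)
    / Real.sqrt (1 - energyMassSq (M.speed (c s) (O.v s)) (mass.m (c s)) E) with hX
  set Z : ℝ → ℝ := fun s => -(M.speed (c s) (O.v s) ^ 2 *
      quad (shadowMatrix K mass.m (O.v s) (M.speed (c s) (O.v s)) E (c Ω₀)) (ρ s))
    / (O.v s ⬝ᵥ ρ s) ^ 2 / (1 - energyMassSq (M.speed (c s) (O.v s)) (mass.m (c s)) E) with hZ
  have hinv := tendsto_inv_atTop_zero.comp hb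
  have hXt : Tendsto X atTop (𝓝 0) := by
    have h := (tendsto_horizontal hc hv hw hτ hα hm hlt hρ hneg).mul hinv
    rw [mul_zero] at h
    refine h.congr fun s => ?_
    exact mul_inv_cancel_right₀ (Real.exp_pos _).ne' _
  have hYt : Tendsto (fun s => Real.sqrt (Z s) / Real.exp (K.Ψ (c s) / 2)) atTop (𝓝 0) := by
    have h := (tendsto_vertical hv hw hm hlt hSt hρ hneg).mul hinv
    rwa [mul_zero] at h
  -- The rescaled projections converge, so the projections themselves tend to `0` and eventually lie
  -- in the unit disc.
  have hle : ∀ᶠ s in atTop,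
      X s ^ 2 + (sgn * (Real.sqrt (Z s) / Real.exp (K.Ψ (c s) / 2))) ^ 2 ≤ 1 := by
    have h := (hXt.pow 2).add ((hYt.const_mul sgn).pow 2)
    norm_num at h
    exact (h.eventually (gt_mem_nhds one_pos)).mono fun s h => h.le
  obtain ⟨p, hp⟩ := (hle.mono fun s h => exists_direction h).choice
  refine ⟨fun s => (p s).1, fun s => (p s).2, ?_⟩
  filter_upwards [hp, hk, hf, hQ, hsurf, eventually_gt_atTop a]
    with s ⟨hΘ, hx, hy⟩ hk hf hQ hsurf hs
  have hwpos := O.speed_pos hs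
  have hZpos : 0 < Z s :=
    div_pos (div_pos (neg_pos.2 (mul_neg_of_pos_of_neg (pow_pos hwpos 2) hQ))
      (sq_pos_of_ne_zero hf.ne)) hk
  have hss : sgn * sgn = 1 := by rcases hsgn with rfl | rfl <;> norm_num
  have hsin : 0 ≤ Real.sin (p s).2 :=
    Real.sin_nonneg_of_nonneg_of_le_pi hΘ.1 (by linarith [hΘ.2, Real.pi_pos])
  refine ⟨(isShadowBoundary_iff hc mass hs hΩ₀ (O.timelike s hs) (O.e2_transverse s hs)
    (O.e2_transverse Ω₀ hΩ₀) (O.e2_unit Ω₀ hΩ₀) hE).2 ⟨hΘ, ?_, hf, hsurf, ?_, ?_⟩, ?_⟩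
  · rw [sub_pos, energyMassSq, div_lt_one (pow_pos hE 2), ← mul_pow, mul_comm] at hk
    exact (lt_of_pow_lt_pow_left₀ 2 hE.le hk).le
  · rw [hx]
    exact mul_div_cancel₀ _ (Real.sqrt_pos.2 hk).ne'
  · rw [hy, mul_pow, sq sgn, hss, one_mul, div_pow, Real.sq_sqrt hZpos.le, ← Real.exp_nat_mul,
      mul_left_comm]
    have : ((2 : ℕ) : ℝ) * (K.Ψ (c s) / 2) = K.Ψ (c s) := by
      push_cast
      ring
    rw [this, mul_div_cancel₀ _ (Real.exp_pos _).ne']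
    exact mul_div_cancel₀ _ hk.ne'
  -- Strict negativity of the limiting shadow form makes the vertical projection nonzero, so its
  -- prescribed sign determines that of `cos Φ`.
  · have h1 : 0 < sgn * Real.cos (p s).1 * Real.sin (p s).2 := by
      rw [mul_assoc, hy, ← mul_assoc, hss, one_mul]
      exact div_pos (Real.sqrt_pos.2 hZpos) (Real.exp_pos _)
    exact (pos_of_mul_pos_left h1 hsin).le

/-! ### Scaling of the shadow with the mass. -/

theorem sqrt_mul_XInf {mE2 : ℝ} (h : mE2 < 1) (ρ : Fin 2 → ℝ) :
    Real.sqrt (1 - mE2) * XInf α vInf vLowInf mE2 ρ = XInf α vInf vLowInf 0 ρ := by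
  have : Real.sqrt (1 - mE2) ≠ 0 := (Real.sqrt_pos.2 (by linarith)).ne'
  rw [XInf, XInf, sub_zero, Real.sqrt_one, one_mul, ← mul_div_assoc, mul_div_mul_left _ _ this]

theorem sqrt_mul_YInf {mE2 : ℝ} (h : mE2 < 1) (sgn : ℝ) (S : Matrix (Fin 2) (Fin 2) ℝ)
    (ρ : Fin 2 → ℝ) :
    Real.sqrt (1 - mE2) * YInf sgn S vInf vLowInf mE2 ρ = YInf sgn S vInf vLowInf 0 ρ := by
  have : Real.sqrt (1 - mE2) ≠ 0 := (Real.sqrt_pos.2 (by linarith)).ne'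
  rw [YInf, YInf, sub_zero, Real.sqrt_one, one_mul, mul_left_comm, ← mul_div_assoc,
    mul_div_mul_left _ _ this]

theorem tendsto_XInf_zero {ι : Type*} {l : Filter ι} {ρ : ι → Fin 2 → ℝ}
    (hρ : Tendsto ρ l (𝓝 ρInf)) (hneg : vInf ⬝ᵥ ρInf < 0) :
    Tendsto (fun k => XInf α vInf vLowInf 0 (ρ k)) l (𝓝 (XInf α vInf vLowInf 0 ρInf)) := by
  refine ((tendsto_dotProduct tendsto_const_nhds hρ).const_mul α).div
    ((tendsto_dotProduct tendsto_const_nhds hρ).const_mul _) (mul_ne_zero ?_ hneg.ne)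
  simp

theorem tendsto_YInf_zero {ι : Type*} {l : Filter ι} {ρ : ι → Fin 2 → ℝ}
    {S : ι → Matrix (Fin 2) (Fin 2) ℝ} {S₀ : Matrix (Fin 2) (Fin 2) ℝ} (hS : Tendsto S l (𝓝 S₀))
    (hρ : Tendsto ρ l (𝓝 ρInf)) (hneg : vInf ⬝ᵥ ρInf < 0) (sgn : ℝ) :
    Tendsto (fun k => YInf sgn (S k) vInf vLowInf 0 (ρ k)) l
      (𝓝 (YInf sgn S₀ vInf vLowInf 0 ρInf)) := by
  refine ((((Real.continuous_sqrt.tendsto _).comp (tendsto_quad hS hρ).neg).const_mul _).div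
    ((tendsto_dotProduct tendsto_const_nhds hρ).const_mul _) (mul_ne_zero ?_ hneg.ne)).const_mul sgn
  simp

section Scaling

variable {x : Coord} {ι : Type*} {l : Filter ι} {mass : ι → SeparableMass K}

theorem tendsto_SInf_massless (hE : E ≠ 0) (hvel : vInf 1 = 0 ∧ vLowInf 0 = -vInf 0)
    (hs : speedInf vInf vLowInf ≠ 0)
    (h : Tendsto (fun k => massTerm K (mass k).m vInf vLowInf E x) l (𝓝 0)) :
    Tendsto (fun k => SInf K (mass k).m vInf vLowInf E x) l
      (𝓝 (SInf K (massless K).m vInf vLowInf E x)) := by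
  refine tendsto_matrix fun i j => ?_
  simp only [SInf_apply_eq_massless hE hvel hs (mass _).m]
  simpa using (h.const_mul (vInf i * vInf j / speedInf vInf vLowInf ^ 2)).const_add
    (SInf K (massless K).m vInf vLowInf E x i j)

theorem tendsto_SInfPrime_massless (hE : E ≠ 0) (hs : speedInf vInf vLowInf ≠ 0) (hx : x ∈ M.U)
    (h : Tendsto (fun k => M.prime (massTerm K (mass k).m vInf vLowInf E) x) l (𝓝 0)) :
    Tendsto (fun k => SInfPrime K (mass k).m vInf vLowInf E x) l
      (𝓝 (SInfPrime K (massless K).m vInf vLowInf E x)) := by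
  refine tendsto_matrix fun i j => ?_
  simp only [SInfPrime_apply_eq_massless (mass _) hE hs hx]
  simpa using (h.const_mul (vInf i * vInf j / speedInf vInf vLowInf ^ 2)).const_add
    (SInfPrime K (massless K).m vInf vLowInf E x i j)

end Scaling

end Shadow

/-! ### Assembly of the theorem. -/

open Shadow in
theorem mainTheorem3
    (M : FoliatedSpacetime) (K : SliceReducible M)
    (a : ℝ) (c : ℝ → Coord) (hc : IsNormalLine M a c)
    (r θ : Coord → ℝ) (N : ℝ) (hflat : AsymptoticallySpherical M a c r θ N)
    (O : Observer M a c) (vInf vLowInf : Fin 2 → ℝ)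
    (hv : Tendsto O.v atTop (𝓝 vInf))
    (hvLow : Tendsto (fun s => M.gram (c s) *ᵥ O.v s) atTop (𝓝 vLowInf))
    (E : ℝ) (hE : 0 < E) (Ω₀ : ℝ) (hΩ₀ : a < Ω₀) :
    -- unbounded and bounded quantities at the position of the distant observer
    Tendsto (fun s => K.Ψ (c s)) atTop atTop ∧
    Tendsto (fun s => M.speed (c s) (O.v s)) atTop (𝓝 (speedInf vInf vLowInf)) ∧
    Tendsto (fun s => M.sqrtDet (c s) • M.tau (c s) (O.v s)) atTop (𝓝 (epsUp *ᵥ vLowInf)) ∧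
    ∃ α : ℝ, 0 < α ∧
      Tendsto (fun s => Real.exp (K.Ψ (c s) / 2) / M.sqrtDet (c s)) atTop (𝓝 α) ∧
      -- the shadow of particles of mass `mass.m`
      (∀ (mass : SeparableMass K) (mInf : ℝ),
        Tendsto (fun s => mass.m (c s)) atTop (𝓝 mInf) →
        energyMassSq (speedInf vInf vLowInf) mInf E < 1 →
        Tendsto (fun s => shadowMatrix K mass.m (O.v s) (M.speed (c s) (O.v s)) E (c Ω₀)) atTop
          (𝓝 (SInf K mass.m vInf vLowInf E (c Ω₀))) ∧
        -- every convergent family of points of the shadow boundary has the stated limit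
        (∀ (ρ : ℝ → Fin 2 → ℝ) (Φ Θ : ℝ → ℝ) (ρInf : Fin 2 → ℝ),
          (∀ᶠ s in atTop,
            IsShadowBoundary K mass (c s) (O.v s) (O.e2 s) E Ω₀ (ρ s) (Φ s) (Θ s)) →
          Tendsto ρ atTop (𝓝 ρInf) →
          vInf ⬝ᵥ ρInf < 0 →
          quad (SInfPrime K mass.m vInf vLowInf E (c Ω₀)) ρInf = 0 ∧
          quad (SInf K mass.m vInf vLowInf E (c Ω₀)) ρInf ≤ 0 ∧
          Tendsto (fun s => stereoX (Φ s) (Θ s) * Real.exp (K.Ψ (c s) / 2)) atTop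
            (𝓝 (XInf α vInf vLowInf (energyMassSq (speedInf vInf vLowInf) mInf E) ρInf)) ∧
          Tendsto (fun s => |stereoY (Φ s) (Θ s)| * Real.exp (K.Ψ (c s) / 2)) atTop
            (𝓝 |YInf 1 (SInf K mass.m vInf vLowInf E (c Ω₀))
              vInf vLowInf (energyMassSq (speedInf vInf vLowInf) mInf E) ρInf|) ∧
          ∀ sgn : ℝ, sgn = 1 ∨ sgn = -1 → (∀ᶠ s in atTop, 0 ≤ sgn * Real.cos (Φ s)) →
            Tendsto (fun s => stereoY (Φ s) (Θ s) * Real.exp (K.Ψ (c s) / 2)) atTop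
              (𝓝 (YInf sgn (SInf K mass.m vInf vLowInf E (c Ω₀))
                vInf vLowInf (energyMassSq (speedInf vInf vLowInf) mInf E) ρInf))) ∧
        -- every convergent family of solutions of the equation for the impact parameter vector
        -- gives such a family of points of the shadow boundary
        (∀ (ρ : ℝ → Fin 2 → ℝ) (ρInf : Fin 2 → ℝ) (sgn : ℝ), sgn = 1 ∨ sgn = -1 →
          (∀ᶠ s in atTop, quad (shadowMatrixPrime K mass.m (O.v s) (M.speed (c s) (O.v s)) E (c Ω₀))
            (ρ s) = 0) →
          Tendsto ρ atTop (𝓝 ρInf) →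
          vInf ⬝ᵥ ρInf < 0 →
          quad (SInf K mass.m vInf vLowInf E (c Ω₀)) ρInf < 0 →
          ∃ Φ Θ : ℝ → ℝ, ∀ᶠ s in atTop,
            IsShadowBoundary K mass (c s) (O.v s) (O.e2 s) E Ω₀ (ρ s) (Φ s) (Θ s) ∧
            0 ≤ sgn * Real.cos (Φ s)) ∧
        -- every nondegenerate solution of the limiting equation is a limit of solutions
        (∀ ρInf : Fin 2 → ℝ, vInf ⬝ᵥ ρInf < 0 →
          quad (SInfPrime K mass.m vInf vLowInf E (c Ω₀)) ρInf = 0 →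
          (SInfPrime K mass.m vInf vLowInf E (c Ω₀)).det < 0 →
          ∃ ρ : ℝ → Fin 2 → ℝ,
            (∀ᶠ s in atTop, quad (shadowMatrixPrime K mass.m (O.v s)
              (M.speed (c s) (O.v s)) E (c Ω₀)) (ρ s) = 0) ∧
            Tendsto ρ atTop (𝓝 ρInf)) ∧
        -- exact scaling when the mass term is absent from the limiting shadow matrix
        (massTerm K mass.m vInf vLowInf E (c Ω₀) = 0 →
          M.prime (massTerm K mass.m vInf vLowInf E) (c Ω₀) = 0 →
          ∀ ρInf : Fin 2 → ℝ, vInf ⬝ᵥ ρInf < 0 →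
            (quad (SInfPrime K mass.m vInf vLowInf E (c Ω₀)) ρInf = 0 ↔
              quad (SInfPrime K (massless K).m vInf vLowInf E (c Ω₀))
                ρInf = 0) ∧
            XInf α vInf vLowInf (energyMassSq (speedInf vInf vLowInf) mInf E) ρInf =
              XInf α vInf vLowInf 0 ρInf /
                Real.sqrt (1 - energyMassSq (speedInf vInf vLowInf) mInf E) ∧
            ∀ sgn : ℝ,
              YInf sgn (SInf K mass.m vInf vLowInf E (c Ω₀))
                  vInf vLowInf (energyMassSq (speedInf vInf vLowInf) mInf E) ρInf =
                YInf sgn (SInf K (massless K).m vInf vLowInf E (c Ω₀))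
                    vInf vLowInf 0 ρInf /
                  Real.sqrt (1 - energyMassSq (speedInf vInf vLowInf) mInf E))) ∧
      -- approximate scaling for a family of masses whose term in the limiting shadow matrix
      -- becomes negligible
      (∀ (ι : Type) (l : Filter ι) (mass : ι → SeparableMass K) (mInf : ι → ℝ),
        (∀ k, Tendsto (fun s => (mass k).m (c s)) atTop (𝓝 (mInf k))) →
        (∀ k, energyMassSq (speedInf vInf vLowInf) (mInf k) E < 1) →
        Tendsto (fun k => massTerm K (mass k).m vInf vLowInf E (c Ω₀)) l (𝓝 0) →
        Tendsto (fun k => M.prime (massTerm K (mass k).m vInf vLowInf E) (c Ω₀)) l (𝓝 0) →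
        (∀ (ρ : ι → Fin 2 → ℝ) (ρ₀ : Fin 2 → ℝ), l.NeBot →
          (∀ᶠ k in l, quad (SInfPrime K (mass k).m vInf vLowInf E (c Ω₀))
            (ρ k) = 0) →
          Tendsto ρ l (𝓝 ρ₀) → vInf ⬝ᵥ ρ₀ < 0 →
          quad (SInfPrime K (massless K).m vInf vLowInf E (c Ω₀)) ρ₀ = 0 ∧
          Tendsto (fun k =>
            Real.sqrt (1 - energyMassSq (speedInf vInf vLowInf) (mInf k) E) *
              XInf α vInf vLowInf (energyMassSq (speedInf vInf vLowInf) (mInf k) E) (ρ k)) l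
            (𝓝 (XInf α vInf vLowInf 0 ρ₀)) ∧
          ∀ sgn : ℝ, Tendsto (fun k =>
            Real.sqrt (1 - energyMassSq (speedInf vInf vLowInf) (mInf k) E) *
              YInf sgn (SInf K (mass k).m vInf vLowInf E (c Ω₀))
                vInf vLowInf (energyMassSq (speedInf vInf vLowInf) (mInf k) E) (ρ k)) l
            (𝓝 (YInf sgn (SInf K (massless K).m vInf vLowInf E (c Ω₀))
              vInf vLowInf 0 ρ₀))) ∧
        (∀ ρ₀ : Fin 2 → ℝ, vInf ⬝ᵥ ρ₀ < 0 →
          quad (SInfPrime K (massless K).m vInf vLowInf E (c Ω₀)) ρ₀ = 0 →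
          (SInfPrime K (massless K).m vInf vLowInf E (c Ω₀)).det < 0 →
          ∃ ρ : ι → Fin 2 → ℝ,
            (∀ᶠ k in l, quad (SInfPrime K (mass k).m vInf vLowInf E (c Ω₀))
              (ρ k) = 0) ∧ Tendsto ρ l (𝓝 ρ₀))) := by
  have hΨ := hc.tendsto_Ψ K hflat
  have hvel := limit_velocity hc hflat hv hvLow
  have hw := M.tendsto_speed hv hvLow
  have hτ : Tendsto (fun s => M.sqrtDet (c s) • M.tau (c s) (O.v s)) atTop
      (𝓝 (epsUp *ᵥ vLowInf)) := by
    have hcont : Continuous fun u : Fin 2 → ℝ => epsUp *ᵥ u := by fun_prop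
    refine ((hcont.tendsto _).comp hvLow).congr' ?_
    filter_upwards [eventually_gt_atTop a] with s hs
    exact (M.sqrtDet_smul_tau (hc.mem s hs) _).symm
  obtain ⟨α, hαpos, hα⟩ := hc.exists_tendsto_exp_div_sqrtDet K hflat
  have hx₀ := hc.mem Ω₀ hΩ₀
  have hwne : ∀ᶠ s in atTop, M.speed (c s) (O.v s) ≠ 0 :=
    (eventually_gt_atTop a).mono fun s hs => (O.speed_pos hs).ne'
  refine ⟨hΨ, hw, hτ, α, hαpos, hα, fun mass mInf hm hlt => ⟨?_, ?_, ?_, ?_, ?_⟩, ?_⟩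
  · exact tendsto_shadowMatrix hvel mass.m E (c Ω₀) hv hwne
  · intro ρ Φ Θ ρInf hsh hρ hneg
    exact shadowBoundary_limit hc hΨ hvel hv hw hτ hα hE hΩ₀ hm hlt hsh hρ hneg
  · intro ρ ρInf sgn hsgn hsurf hρ hneg hS
    exact exists_shadowBoundary hc hΨ hvel hv hw hτ hα hE hΩ₀ hm hlt hsgn hsurf hρ hneg hS
  · intro ρInf hneg h0 hdet
    -- The perturbed forms are the prime shadow matrices of observers at finite distance; in the
    -- approximate scaling below they are those of the family of masses.
    exact exists_tendsto_isotropic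
      (tendsto_shadowMatrixPrime mass (speedInf_pos hvel hneg).ne' E hx₀ hv hwne) hdet
      (ne_zero_of_dotProduct_neg hneg) h0
  · intro hT hT' ρInf hneg
    have hs0 := (speedInf_pos hvel hneg).ne'
    have hS : SInf K mass.m vInf vLowInf E (c Ω₀)
        = SInf K (massless K).m vInf vLowInf E (c Ω₀) := by
      ext i j
      rw [SInf_apply_eq_massless hE.ne' hvel hs0 mass.m, hT, mul_zero, add_zero]
    have hS' : SInfPrime K mass.m vInf vLowInf E (c Ω₀)
        = SInfPrime K (massless K).m vInf vLowInf E (c Ω₀) := by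
      ext i j
      rw [SInfPrime_apply_eq_massless mass hE.ne' hs0 hx₀, hT', mul_zero, add_zero]
    have hk : Real.sqrt (1 - energyMassSq (speedInf vInf vLowInf) mInf E) ≠ 0 :=
      (Real.sqrt_pos.2 (by linarith)).ne'
    refine ⟨by rw [hS'], ?_, fun sgn => ?_⟩
    · rw [eq_div_iff hk, mul_comm, sqrt_mul_XInf hlt]
    · rw [eq_div_iff hk, mul_comm, sqrt_mul_YInf hlt, hS]
  · intro ι l mass mInf _ hlt hT hT'
    refine ⟨fun ρ ρ₀ hl h0 hρ hneg => ?_, fun ρ₀ hneg h0 hdet => ?_⟩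
    · have hs0 := (speedInf_pos hvel hneg).ne'
      refine ⟨?_, ?_, fun sgn => ?_⟩
      · exact tendsto_nhds_unique
          (tendsto_quad (tendsto_SInfPrime_massless hE.ne' hs0 hx₀ hT') hρ)
          (tendsto_const_nhds.congr' (h0.mono fun _ h => h.symm))
      · simp only [sqrt_mul_XInf (hlt _)]
        exact tendsto_XInf_zero hρ hneg
      · simp only [sqrt_mul_YInf (hlt _)]
        exact tendsto_YInf_zero (tendsto_SInf_massless hE.ne' hvel hs0 hT) hρ hneg sgn
    · exact exists_tendsto_isotropic
        (tendsto_SInfPrime_massless hE.ne' (speedInf_pos hvel hneg).ne' hx₀ hT') hdet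
        (ne_zero_of_dotProduct_neg hneg) h0
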